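/- Let $(\tilde M,J,g)$ be a locally conformally Kähler (LCK) manifold: a complex manifold with a Hermitian metric $g$ such that every point has an open neighbourhood $U$ and a smooth $\varphi:U\to\mathbb R$ for which $e^{-\varphi}g$ is a Kähler metric on $U$ (i.e. $J$ is parallel for its Levi-Civita connection). Let $\Omega(X,Y)=g(X,JY)$, let $\alpha$ be the Lee form, normalized as the closed 1-form with $d\Omega=2\,\alpha\wedge\Omega$ (so $\alpha=\tfrac12\,d\varphi$ on $U$ when $\dim_{\mathbb C}\tilde M\ge 2$), and let $\alpha^{\#}$ be the Lee vector field, $g(X,\alpha^{\#})=\alpha(X)$. With $\tilde\nabla$ the Levi-Civita connection of $g$, this is the normalization in which $$(\tilde\nabla_XJ)Y=\alpha(JY)X-\alpha(Y)JX+g(JX,Y)\alpha^{\#}+g(X,Y)J\alpha^{\#}.$$ Let $N^T$ and $N^\theta$ be Riemannian manifolds with metrics $g_T,g_\theta$, let $f$ be a positive smooth function on $N^T$, and let $M=N^T\times_fN^\theta$ be the product manifold with the warped product metric $\pi_1^*g_T+(f\circ\pi_1)^2\pi_2^*g_\theta$, isometrically immersed in $\tilde M$. Denote by $\mathfrak D$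 and $\mathfrak D^\theta$ the distributions on $M$ tangent to $N^T$ and $N^\theta$. For $X$ tangent to $M$ let $PX$ and $FX$ be the tangential and the normal component of $JX$. Let $h$ be the second fundamental form of $M$ in $\tilde M$, and for a normal vector $\xi$ let $A_\xi$ be the shape operator, $g(A_\xi X,Y)=g(h(X,Y),\xi)$. Assume that $M$ is a proper pointwise semi-slant submanifold with respect to $\mathfrak D\oplus\mathfrak D^\theta$: $J\mathfrak D=\mathfrak D$; there is a function $\theta:M\to\mathbb R$ such that for every $p\in M$ and every nonzero $Z\in\mathfrak D^\theta_p$ the angle between $JZ$ and $\mathfrak D^\theta_p$ is $\theta(p)$; $\dim N^T\neq0$; and $\cos^2\theta>0$ on $M$. Assume also that $\alpha^{\#}$ is tangent to $M$ along $M$. Then 1. $g(A_{FZ}X,Y)=0$, 2. $g(A_{FZ}JX-A_{FPZ}X,\,W)=\sin^2\theta\,\bigl(X(\ln f)-\alpha(X)\bigr)\,g(Z,W)$ for all $X,Y\in\mathfrak D$ and $Z,W\in\mathfrak D^\theta$ at the same point of $M$. -/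

import Mathlib

open Bundle Set
open scoped Manifold ContDiff

noncomputable section

namespace SemiSlantWarped

/-! ### Linear algebra -/

section Linear

variable {V W : Type*}

/-- `IsRepr B φ u` says that the vector `u` represents the functional `φ` through the scalar
product `B`, that is `B u w = φ w` for all `w`. -/
def IsRepr (B : V → V → ℝ) (φ : V → ℝ) (u : V) : Prop := ∀ w, B u w = φ w

open Classical in
/-- The dual vector `φ^♯` of the functional `φ` with respect to the scalar product `B`, the vector
with `B (φ^♯) w = φ w` for all `w`. It exists and is unique when `B` is a scalar product on
a finite-dimensional space and `φ` is linear, see `sharp_spec` and `eq_sharp`. -/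
def sharp [Zero V] (B : V → V → ℝ) (φ : V → ℝ) : V :=
  if h : ∃ u, IsRepr B φ u then h.choose else 0

theorem sharp_spec [AddCommGroup V] [Module ℝ V] [FiniteDimensional ℝ V]
    (B : V →ₗ[ℝ] V →ₗ[ℝ] ℝ) (hB : ∀ v, v ≠ 0 → 0 < B v v) (φ : V →ₗ[ℝ] ℝ) (w : V) :
    B (sharp (fun v w => B v w) φ) w = φ w := by
  have hinj : Function.Injective B := by
    rw [injective_iff_map_eq_zero]
    intro v hv
    by_contra hne
    have := hB v hne
    simp [hv] at this
  have hsurj : Function.Surjective B :=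
    (LinearMap.injective_iff_surjective_of_finrank_eq_finrank
      (Subspace.dual_finrank_eq (K := ℝ) (V := V)).symm).1 hinj
  obtain ⟨u, hu⟩ := hsurj φ
  have h : ∃ u, IsRepr (fun v w => B v w) φ u := ⟨u, fun w => by simp [hu]⟩
  have := h.choose_spec w
  simpa [sharp, h] using this

theorem eq_sharp [AddCommGroup V] [Module ℝ V] [FiniteDimensional ℝ V]
    (B : V →ₗ[ℝ] V →ₗ[ℝ] ℝ) (hB : ∀ v, v ≠ 0 → 0 < B v v) (φ : V →ₗ[ℝ] ℝ) (u : V)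
    (hu : ∀ w, B u w = φ w) : u = sharp (fun v w => B v w) φ := by
  by_contra hne
  have h := hB (u - sharp (fun v w => B v w) φ) (sub_ne_zero.2 hne)
  have hz : B (u - sharp (fun v w => B v w) φ) = 0 := by
    ext w
    rw [map_sub, LinearMap.sub_apply, hu, sharp_spec B hB φ, sub_self, LinearMap.zero_apply]
  rw [hz, LinearMap.zero_apply] at h
  exact lt_irrefl _ h

/-- For an injective linear map `L : W → V` into a space with scalar product `B`, the vector
`u^⊤` of `W` whose image `L u^⊤` is the `B`-orthogonal projection of `u` to the range of `L`. -/
def projPart [Zero W] (B : V → V → ℝ) (L : W → V) (u : V) : W :=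
  sharp (fun a b => B (L a) (L b)) (fun a => B u (L a))

/-- The angle, in `[0, π/2]`, between a nonzero vector `u` and the range of the injective linear
map `L`: the angle between `u` and its orthogonal projection to the range. -/
def angleToRange [Zero W] (B : V → V → ℝ) (L : W → V) (u : V) : ℝ :=
  Real.arccos (√(B (L (projPart B L u)) (L (projPart B L u))) / √(B u u))

end Linear

/-! ### Tensor fields, connections, and locally conformally Kähler structures -/

section Ambient

variable {E : Type*} [NormedAddCommGroup E] [NormedSpace ℝ E]
  {H : Type*} [TopologicalSpace H] (I : ModelWithCorners ℝ E H)
  {M : Type*} [TopologicalSpace M] [ChartedSpace H M] [IsManifold I ∞ M]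

variable (M) in
/-- Smooth Riemannian metrics on the manifold `M`. -/
abbrev RMetric :=
  ContMDiffRiemannianMetric I ∞ E (fun x : M => TangentSpace I x)

/-- The vector field `X` is differentiable at `x`. -/
def DiffField (X : Π x : M, TangentSpace I x) (x : M) : Prop :=
  MDifferentiableAt I (I.prod 𝓘(ℝ, E)) (fun y => TotalSpace.mk' E y (X y)) x

/-- The vector field `X` is smooth near `x`. -/
def SmoothField (X : Π x : M, TangentSpace I x) (x : M) : Prop :=
  ContMDiffAt I (I.prod 𝓘(ℝ, E)) ∞ (fun y => TotalSpace.mk' E y (X y)) x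

variable {I}

/-- `cov` is a Levi-Civita connection of the metric `g` on the open set `U`: a covariant derivative
which is torsion-free and compatible with `g`. As in Mathlib, `cov Y x v` is `∇_v Y` at `x`. -/
structure IsLeviCivitaOn
    (g : Π x : M, TangentSpace I x →L[ℝ] TangentSpace I x →L[ℝ] ℝ)
    (cov : (Π x : M, TangentSpace I x) → (Π x : M, TangentSpace I x →L[ℝ] TangentSpace I x))
    (U : Set M) : Prop where
  isCov : IsCovariantDerivativeOn E cov U
  torsionFree : ∀ x ∈ U, ∀ X Y : (Π x : M, TangentSpace I x), DiffField I X x → DiffField I Y x →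
    cov Y x (X x) - cov X x (Y x) = VectorField.mlieBracket I X Y x
  metric : ∀ x ∈ U, ∀ Y Z : (Π x : M, TangentSpace I x), DiffField I Y x → DiffField I Z x →
    ∀ v : TangentSpace I x,
      mvfderiv I (fun y => g y (Y y) (Z y)) x v = g x (cov Y x v) (Z x) + g x (Y x) (cov Z x v)

/-- `∇J = 0` on `U`, that is `∇_v (J Y) = J ∇_v Y`. -/
def IsParallelOn
    (cov : (Π x : M, TangentSpace I x) → (Π x : M, TangentSpace I x →L[ℝ] TangentSpace I x))
    (J : Π x : M, TangentSpace I x →L[ℝ] TangentSpace I x) (U : Set M) : Prop :=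
  ∀ x ∈ U, ∀ Y : (Π x : M, TangentSpace I x), DiffField I Y x →
    ∀ v : TangentSpace I x, cov (fun y => J y (Y y)) x v = J x (cov Y x v)

/-- `J` is a complex structure: a smooth almost complex structure whose Nijenhuis tensor
vanishes. -/
structure IsComplexStructure (J : Π x : M, TangentSpace I x →L[ℝ] TangentSpace I x) : Prop where
  smooth : ContMDiff I (I.prod 𝓘(ℝ, E →L[ℝ] E)) ∞
    (fun x => TotalSpace.mk' (E →L[ℝ] E)
      (E := fun x : M => TangentSpace I x →L[ℝ] TangentSpace I x) x (J x))
  sq : ∀ x (v : TangentSpace I x), J x (J x v) = -v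
  integrable : ∀ x (X Y : Π x : M, TangentSpace I x), SmoothField I X x → SmoothField I Y x →
    VectorField.mlieBracket I (fun y => J y (X y)) (fun y => J y (Y y)) x
      - J x (VectorField.mlieBracket I (fun y => J y (X y)) Y x)
      - J x (VectorField.mlieBracket I X (fun y => J y (Y y)) x)
      - VectorField.mlieBracket I X Y x = 0

/-- `(M, J, g)` is a locally conformally Kähler manifold: `J` is a complex structure, `g` is
Hermitian, and every point has an open neighbourhood `U` with a smooth function `φ` on `U` such that
`e^{-φ} g` is a Kähler metric on `U`, i.e. `J` is parallel for its Levi-Civita connection. -/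
structure IsLCK (g : RMetric I M) (J : Π x : M, TangentSpace I x →L[ℝ] TangentSpace I x) :
    Prop where
  complex : IsComplexStructure J
  hermitian : ∀ x (v w : TangentSpace I x), g.inner x (J x v) (J x w) = g.inner x v w
  locally_conformal : ∀ x : M, ∃ U : Set M, IsOpen U ∧ x ∈ U ∧
    ∃ φ : M → ℝ, ContMDiffOn I 𝓘(ℝ, ℝ) ∞ φ U ∧
      ∃ cov, IsLeviCivitaOn (fun y => Real.exp (-φ y) • g.inner y) cov U ∧ IsParallelOn cov J U

/-- The fundamental 2-form `Ω(X, Y) = g(X, JY)`. -/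
def fundForm (g : RMetric I M) (J : Π x : M, TangentSpace I x →L[ℝ] TangentSpace I x)
    (x : M) (v w : TangentSpace I x) : ℝ :=
  g.inner x v (J x w)

/-- The exterior derivative of a 1-form on two vector fields,
`dα(X, Y) = X α(Y) - Y α(X) - α([X, Y])`. -/
def extDerivOne (α : Π x : M, TangentSpace I x → ℝ) (X Y : Π x : M, TangentSpace I x)
    (x : M) : ℝ :=
  mvfderiv I (fun y => α y (Y y)) x (X x) - mvfderiv I (fun y => α y (X y)) x (Y x)
    - α x (VectorField.mlieBracket I X Y x)

/-- The exterior derivative of a 2-form on three vector fields,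
`dη(X, Y, Z) = X η(Y, Z) + Y η(Z, X) + Z η(X, Y) - η([X, Y], Z) - η([Y, Z], X) - η([Z, X], Y)`. -/
def extDerivTwo (η : Π x : M, TangentSpace I x → TangentSpace I x → ℝ)
    (X Y Z : Π x : M, TangentSpace I x) (x : M) : ℝ :=
  mvfderiv I (fun y => η y (Y y) (Z y)) x (X x)
    + mvfderiv I (fun y => η y (Z y) (X y)) x (Y x)
    + mvfderiv I (fun y => η y (X y) (Y y)) x (Z x)
    - η x (VectorField.mlieBracket I X Y x) (Z x)
    - η x (VectorField.mlieBracket I Y Z x) (X x)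
    - η x (VectorField.mlieBracket I Z X x) (Y x)

/-- The wedge product of a 1-form and a 2-form,
`(α ∧ η)(u, v, w) = α(u) η(v, w) + α(v) η(w, u) + α(w) η(u, v)`. -/
def wedgeOneTwo {V : Type*} (α : V → ℝ) (η : V → V → ℝ) (u v w : V) : ℝ :=
  α u * η v w + α v * η w u + α w * η u v

/-- `α` is the Lee form of `(M, J, g)`: a smooth closed 1-form with `dΩ = 2 α ∧ Ω`. In
complex dimension at least 2 this means `α = ½ dφ` wherever `e^{-φ} g` is a Kähler metric. It is the normalization for which
`(∇_X J) Y = α(JY) X - α(Y) JX + g(JX, Y) α^♯ + g(X, Y) J α^♯`. -/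
structure IsLeeForm (g : RMetric I M) (J : Π x : M, TangentSpace I x →L[ℝ] TangentSpace I x)
    (α : Π x : M, TangentSpace I x →L[ℝ] ℝ) : Prop where
  smooth : ContMDiff I (I.prod 𝓘(ℝ, E →L[ℝ] ℝ)) ∞
    (fun x => TotalSpace.mk' (E →L[ℝ] ℝ) (E := fun x : M => TangentSpace I x →L[ℝ] ℝ) x (α x))
  closed : ∀ x (X Y : Π x : M, TangentSpace I x), SmoothField I X x → SmoothField I Y x →
    extDerivOne (fun y v => α y v) X Y x = 0
  extDeriv_fundForm : ∀ x (X Y Z : Π x : M, TangentSpace I x),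
    SmoothField I X x → SmoothField I Y x → SmoothField I Z x →
    extDerivTwo (fundForm g J) X Y Z x
      = 2 * wedgeOneTwo (fun v => α x v) (fundForm g J x) (X x) (Y x) (Z x)

/-- The Lee vector field `λ = α^♯`. -/
def leeField (g : RMetric I M) (α : Π x : M, TangentSpace I x →L[ℝ] ℝ) (x : M) :
    TangentSpace I x :=
  sharp (fun v w => g.inner x v w) (fun v => α x v)

end Ambient

/-! ### Submanifold geometry of a map `ι : M → M'` -/

section Submanifold

variable {E : Type*} [NormedAddCommGroup E] [NormedSpace ℝ E]
  {H : Type*} [TopologicalSpace H] {I : ModelWithCorners ℝ E H}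
  {M : Type*} [TopologicalSpace M] [ChartedSpace H M] [IsManifold I ∞ M]
  {E' : Type*} [NormedAddCommGroup E'] [NormedSpace ℝ E']
  {H' : Type*} [TopologicalSpace H'] {I' : ModelWithCorners ℝ E' H'}
  {M' : Type*} [TopologicalSpace M'] [ChartedSpace H' M'] [IsManifold I' ∞ M']

/-- The metric on `M` induced by `ι` from the metric `g` of `M'`. -/
def inducedMetric (g : RMetric I' M') (ι : M → M') (p : M) (v w : TangentSpace I p) : ℝ :=
  g.inner (ι p) (mfderiv I I' ι p v) (mfderiv I I' ι p w)

/-- The tangential component of a vector of `M'` at `ι p`, as a vector tangent to `M` at `p`. -/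
def tangentialPart (g : RMetric I' M') (ι : M → M') (p : M) (u : TangentSpace I' (ι p)) :
    TangentSpace I p :=
  projPart (fun v w => g.inner (ι p) v w) (fun v : TangentSpace I p => mfderiv I I' ι p v) u

variable (I) in
/-- The normal component of a vector of `M'` at `ι p`. -/
def normalPart (g : RMetric I' M') (ι : M → M') (p : M) (u : TangentSpace I' (ι p)) :
    TangentSpace I' (ι p) :=
  u - mfderiv I I' ι p (tangentialPart g ι p u : TangentSpace I p)

/-- `P X`, the tangential component of `J X`. -/
def opP (g : RMetric I' M') (J : Π x : M', TangentSpace I' x →L[ℝ] TangentSpace I' x)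
    (ι : M → M') (p : M) (X : TangentSpace I p) : TangentSpace I p :=
  tangentialPart g ι p (J (ι p) (mfderiv I I' ι p X))

/-- `F X`, the normal component of `J X`. -/
def opF (g : RMetric I' M') (J : Π x : M', TangentSpace I' x →L[ℝ] TangentSpace I' x)
    (ι : M → M') (p : M) (X : TangentSpace I p) : TangentSpace I' (ι p) :=
  normalPart I g ι p (J (ι p) (mfderiv I I' ι p X))

/-- The covariant derivative `∇_v s` at `p` of a vector field `s` along `ι`, induced by the
connection `cov` of `M'`. If `e_i` are the constant fields of the local trivialization of `TM'`
centred at `ι p` and `s = ∑ s^i (e_i ∘ ι)`, then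
`∇_v s = ∑ (d s^i (v) e_i + s^i(p) ∇_{dι v} e_i)`; the second sum is the covariant derivative of the
constant extension `∑ s^i(p) e_i` of the vector `s(p)`. -/
def covAlong
    (cov : (Π x : M', TangentSpace I' x) → (Π x : M', TangentSpace I' x →L[ℝ] TangentSpace I' x))
    (ι : M → M') (s : Π q : M, TangentSpace I' (ι q)) (p : M) (v : TangentSpace I p) :
    TangentSpace I' (ι p) :=
  let e := trivializationAt E' (fun x : M' => TangentSpace I' x) (ι p)
  e.symm (ι p)
      (mvfderiv I (fun q => (e (TotalSpace.mk' E' (ι q) (s q))).2) p v)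
    + cov (FiberBundle.extend E' (s p)) (ι p) (mfderiv I I' ι p v)

/-- The second fundamental form `h(v, w)`: the normal component of `∇_v dι(Y)` for a vector field
`Y` on `M` with `Y(p) = w`. It does not depend on the choice of `Y`; the field used here is the one
which is constant in the preferred chart at `p`. -/
def secondFundamentalForm (g : RMetric I' M')
    (cov : (Π x : M', TangentSpace I' x) → (Π x : M', TangentSpace I' x →L[ℝ] TangentSpace I' x))
    (ι : M → M') (p : M) (v w : TangentSpace I p) : TangentSpace I' (ι p) :=
  normalPart I g ι p
    (covAlong cov ι (fun q => mfderiv I I' ι q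
      (FiberBundle.extend E (E := fun x : M => TangentSpace I x) w q)) p v)

/-- The shape operator: `A_ξ v` is the vector tangent to `M` with `g(A_ξ v, w) = g(h(v, w), ξ)` for
all `w` tangent to `M`. -/
def shapeOperator (g : RMetric I' M')
    (cov : (Π x : M', TangentSpace I' x) → (Π x : M', TangentSpace I' x →L[ℝ] TangentSpace I' x))
    (ι : M → M') (p : M) (ξ : TangentSpace I' (ι p)) (v : TangentSpace I p) : TangentSpace I p :=
  sharp (inducedMetric g ι p)
    (fun w => g.inner (ι p) (secondFundamentalForm g cov ι p v w) ξ)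

/-- The submanifold `ι : M → M'` is pointwise semi-slant with respect to the distributions `D` and
`Dθ` and the slant function `θ`: `TM` is the orthogonal direct sum of `D` and `Dθ`, the distribution
`D` is `J`-invariant, and for every nonzero `Z` in `Dθ` at `p` the angle between `JZ` and `Dθ` is
`θ p`. -/
structure IsPointwiseSemiSlant (g : RMetric I' M')
    (J : Π x : M', TangentSpace I' x →L[ℝ] TangentSpace I' x) (ι : M → M')
    (D Dθ : Π p : M, Submodule ℝ (TangentSpace I p)) (θ : M → ℝ) : Prop where
  isCompl : ∀ p, IsCompl (D p) (Dθ p)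
  orthogonal : ∀ p, ∀ X ∈ D p, ∀ Z ∈ Dθ p, inducedMetric g ι p X Z = 0
  invariant : ∀ p, ((D p).map (mfderiv I I' ι p).toLinearMap).map (J (ι p)).toLinearMap
    = (D p).map (mfderiv I I' ι p).toLinearMap
  slant : ∀ p, ∀ Z ∈ Dθ p, Z ≠ 0 →
    angleToRange (fun v w => g.inner (ι p) v w)
      (fun W : Dθ p => mfderiv I I' ι p (W : TangentSpace I p))
      (J (ι p) (mfderiv I I' ι p Z)) = θ p

end Submanifold

/-! ### Warped products -/

section Warped

variable {E₁ : Type*} [NormedAddCommGroup E₁] [NormedSpace ℝ E₁]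
  {H₁ : Type*} [TopologicalSpace H₁] {I₁ : ModelWithCorners ℝ E₁ H₁}
  {N₁ : Type*} [TopologicalSpace N₁] [ChartedSpace H₁ N₁] [IsManifold I₁ ∞ N₁]
  {E₂ : Type*} [NormedAddCommGroup E₂] [NormedSpace ℝ E₂]
  {H₂ : Type*} [TopologicalSpace H₂] {I₂ : ModelWithCorners ℝ E₂ H₂}
  {N₂ : Type*} [TopologicalSpace N₂] [ChartedSpace H₂ N₂] [IsManifold I₂ ∞ N₂]

/-- The warped product metric `g₁(π₁_* X, π₁_* Y) + (f ∘ π₁)² g₂(π₂_* X, π₂_* Y)` on `N₁ × N₂`. -/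
def warpedMetric (g₁ : RMetric I₁ N₁) (g₂ : RMetric I₂ N₂) (f : N₁ → ℝ) (p : N₁ × N₂)
    (X Y : TangentSpace (I₁.prod I₂) p) : ℝ :=
  g₁.inner p.1 (mfderiv (I₁.prod I₂) I₁ Prod.fst p X) (mfderiv (I₁.prod I₂) I₁ Prod.fst p Y)
    + f p.1 ^ 2 *
      g₂.inner p.2 (mfderiv (I₁.prod I₂) I₂ Prod.snd p X) (mfderiv (I₁.prod I₂) I₂ Prod.snd p Y)

variable (I₁ I₂) in
/-- The vectors of `N₁ × N₂` tangent to the first factor. -/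
def firstFactor (p : N₁ × N₂) : Submodule ℝ (TangentSpace (I₁.prod I₂) p) :=
  LinearMap.ker (mfderiv (I₁.prod I₂) I₂ (Prod.snd : N₁ × N₂ → N₂) p).toLinearMap

variable (I₁ I₂) in
/-- The vectors of `N₁ × N₂` tangent to the second factor. -/
def secondFactor (p : N₁ × N₂) : Submodule ℝ (TangentSpace (I₁.prod I₂) p) :=
  LinearMap.ker (mfderiv (I₁.prod I₂) I₁ (Prod.fst : N₁ × N₂ → N₁) p).toLinearMap

end Warped

end SemiSlantWarped

end

open SemiSlantWarped

/-! Everything is computed at one point `p`. Tangent vectors are extended by fields constant in the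
preferred chart. These commute, and in the product charts of `N^T × N^θ` they stay tangent to the
factors. Write `D w v = ∇_v (dι w)` (`ambientDeriv`); it is symmetric in `v` and `w`. By
`inducedMetric_shapeOperator` both claims are about `g(D X W, FZ)`, where `FZ = JZ - PZ`.

Against tangent vectors, `D` is governed by the warped metric. The Koszul argument (`koszul_first`,
`koszul_second`) gives `g(∇_X Y, Z) = 0` and `g(∇_X Z, W) = X(ln f) g(Z, W)` for `X, Y` in `𝔇` and
`Z, W` in `𝔇^θ`.

Against `JZ` the LCK structure enters. Since `J𝔇 = 𝔇` is orthogonal to `𝔇^θ`, the function `g(Y,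
JZ)` vanishes on `M`. Differentiating it with the connection of a local Kähler metric `e^{-φ} g`,
which commutes with `J`, and subtracting the conformal correction expresses `g(D Y v, JZ)` by `g(JY,
D Z v)` and the Lee form (`inner_J_of_lck`). The correction contains `dφ`. The equality `dφ = 2α` is
needed only on vectors orthogonal to some complex line, where `dΩ = 2 α ∧ Ω` yields it
(`IsLeeForm.two_mul_eq`), so no separate dimension assumption is needed.

Comparing the formulas for `∇_X (JX)` and `∇_{JX} X` forces `α = 0` on `𝔇^θ`
(`lee_eq_zero_on_second`). As `α^#` is tangent, `α(JZ) = α(PZ) = 0` too. The first identity follows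
because every term vanishes. The second combines the mixed formula at `(JX, Z)` and `(X, PZ)`, with
`P² = -1` on `𝔇` and `P² = -cos² θ` on `𝔇^θ`. -/

namespace SemiSlantWarped

open scoped Topology

set_option linter.unusedSectionVars false

/-! ### Fields constant in the preferred chart. -/

section Extend

variable {E : Type*} [NormedAddCommGroup E] [NormedSpace ℝ E]
  {H : Type*} [TopologicalSpace H] {I : ModelWithCorners ℝ E H}
  {M : Type*} [TopologicalSpace M] [ChartedSpace H M] [IsManifold I ∞ M]

/-- At its centre the tangent trivialization is the derivative of the extended chart, which is the
identity under `TangentSpace I x = E`. -/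
theorem trivializationAt_self_snd (x : M) (v : TangentSpace I x) :
    (trivializationAt E (TangentSpace I) x ⟨x, v⟩).2 = v := by
  have h := TangentBundle.continuousLinearMapAt_trivializationAt (I := I) (x₀ := x) (x := x)
    (mem_chart_source H x)
  rw [mfderiv_extChartAt_self] at h
  exact ((trivializationAt E (TangentSpace I) x).continuousLinearMapAt_apply_of_mem (R := ℝ)
    (FiberBundle.mem_baseSet_trivializationAt' x) v).symm.trans (congrArg (fun A => A v) h)

theorem trivializationAt_self_symm (x : M) (v : E) :
    (trivializationAt E (TangentSpace I) x).symm x v = v := by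
  have h := TangentBundle.symmL_trivializationAt (I := I) (x₀ := x) (x := x)
    (mem_chart_source H x)
  rw [mfderivWithin_range_extChartAt_symm] at h
  exact ((trivializationAt E (TangentSpace I) x).symmL_apply (R := ℝ)
    (FiberBundle.mem_baseSet_trivializationAt' x) v).symm.trans (congrArg (fun A => A v) h)

theorem extend_eq_symmL {x y : M} (hy : y ∈ (chartAt H x).source) (w : TangentSpace I x) :
    FiberBundle.extend E w y = (trivializationAt E (TangentSpace I) x).symmL ℝ y w := by
  rw [FiberBundle.extend, trivializationAt_self_snd]
  exact ((trivializationAt E (TangentSpace I) x).symmL_apply (R := ℝ) hy w).symm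

theorem extend_eq_mfderivWithin {x y : M} (hy : y ∈ (chartAt H x).source)
    (w : TangentSpace I x) :
    FiberBundle.extend E w y
      = mfderivWithin 𝓘(ℝ, E) I (extChartAt I x).symm (range I) (extChartAt I x y) w := by
  rw [extend_eq_symmL hy, TangentBundle.symmL_trivializationAt hy]
  rfl

theorem smoothField_extend {x : M} (w : TangentSpace I x) :
    SmoothField I (FiberBundle.extend E w) x :=
  FiberBundle.contMDiffAt_extend I E w

theorem diffField_extend {x : M} (w : TangentSpace I x) :
    DiffField I (FiberBundle.extend E w) x :=
  FiberBundle.mdifferentiableAt_extend I E w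

theorem lieBracketWithin_const_const (v w : E) (s : Set E) (x : E) :
    VectorField.lieBracketWithin ℝ (fun _ => v) (fun _ => w) s x = 0 := by
  simp [VectorField.lieBracketWithin]

/-- Pulled back by the inverse chart, both fields are constant near the base point. This removes
every bracket term from the torsion identity and from `dΩ`. -/
theorem mlieBracket_extend {x : M} (v w : TangentSpace I x) :
    VectorField.mlieBracket I (FiberBundle.extend E v) (FiberBundle.extend E w) x = 0 := by
  have key : ∀ u : TangentSpace I x,
      VectorField.mpullbackWithin 𝓘(ℝ, E) I (extChartAt I x).symm
        (FiberBundle.extend E u) (range I) =ᶠ[𝓝[range I] (extChartAt I x x)] fun _ => u := by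
    intro u
    filter_upwards [extChartAt_target_mem_nhdsWithin (I := I) x] with z hz
    have hz' : (extChartAt I x).symm z ∈ (chartAt H x).source := by
      rw [← extChartAt_source (I := I)]
      exact (extChartAt I x).map_target hz
    rw [VectorField.mpullbackWithin_apply, extend_eq_mfderivWithin hz',
      (extChartAt I x).right_inv hz]
    exact (isInvertible_mfderivWithin_extChartAt_symm hz).inverse_apply_self u
  rw [← VectorField.mlieBracketWithin_univ, VectorField.mlieBracketWithin_apply,
    preimage_univ, univ_inter]
  rw [(key v).lieBracketWithin_vectorField_eq_of_mem (key w) (mem_range_self _)]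
  exact (congrArg _ (lieBracketWithin_const_const (E := E) v w _ _)).trans (map_zero _)

end Extend

/-! ### First and second derivatives of the immersion in charts. -/

section Coord

variable {E : Type*} [NormedAddCommGroup E] [NormedSpace ℝ E]
  {H : Type*} [TopologicalSpace H] {I : ModelWithCorners ℝ E H} [I.Boundaryless]
  {M : Type*} [TopologicalSpace M] [ChartedSpace H M] [IsManifold I ∞ M]
  {E' : Type*} [NormedAddCommGroup E'] [NormedSpace ℝ E']
  {H' : Type*} [TopologicalSpace H'] {I' : ModelWithCorners ℝ E' H'}
  {M' : Type*} [TopologicalSpace M'] [ChartedSpace H' M'] [IsManifold I' ∞ M']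

/-- The coordinates, in the trivialization centred at `ι p`, of the image under `ι` of the field
which is constant in the preferred chart at `p`. -/
noncomputable def coordDeriv (ι : M → M') {p : M} (w : TangentSpace I p) (q : M) : E' :=
  (trivializationAt E' (fun x : M' => TangentSpace I' x) (ι p)
    (TotalSpace.mk' E' (ι q) (mfderiv I I' ι q (FiberBundle.extend E w q)))).2

/-- The chain rule for chart, map and inverse chart; without boundary, the derivative within `range
I` is the full derivative. -/
theorem coordDeriv_eventuallyEq {ι : M → M'} (hι : ContMDiff I I' ∞ ι) {p : M}
    (w : TangentSpace I p) :
    (coordDeriv (I' := I') ι w : M → E') =ᶠ[𝓝 p]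
      fun q => fderiv ℝ (writtenInExtChartAt I I' p ι) (extChartAt I p q) w := by
  have h1 : ∀ᶠ q in 𝓝 p, q ∈ (chartAt H p).source := chart_source_mem_nhds H p
  have h2 : ∀ᶠ q in 𝓝 p, ι q ∈ (chartAt H' (ι p)).source :=
    hι.continuous.continuousAt.eventually (chart_source_mem_nhds H' (ι p))
  filter_upwards [h1, h2] with q hq hq'
  have hq1 : q ∈ (extChartAt I p).source := by rwa [extChartAt_source]
  have hc := TangentBundle.continuousLinearMapAt_trivializationAt (I := I') hq'
  have e1 : coordDeriv (I' := I') ι w q = mfderiv I' 𝓘(ℝ, E') (extChartAt I' (ι p)) (ι q)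
      (mfderiv I I' ι q (FiberBundle.extend E w q)) := by
    rw [← hc]
    exact ((trivializationAt E' (TangentSpace I') (ι p)).continuousLinearMapAt_apply_of_mem (R := ℝ)
      hq' _).symm
  rw [e1, extend_eq_mfderivWithin hq]
  have hx : (extChartAt I p).symm (extChartAt I p q) = q := (extChartAt I p).left_inv hq1
  have d1 : MDifferentiableWithinAt 𝓘(ℝ, E) I (extChartAt I p).symm (range I)
      (extChartAt I p q) :=
    mdifferentiableWithinAt_extChartAt_symm ((extChartAt I p).map_source hq1)
  have d2 : MDifferentiableAt I I' ι q := hι.mdifferentiableAt (by simp)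
  have d3 : MDifferentiableAt I' 𝓘(ℝ, E') (extChartAt I' (ι p)) (ι q) :=
    mdifferentiableAt_extChartAt hq'
  have d4 : MDifferentiableAt I 𝓘(ℝ, E') (extChartAt I' (ι p) ∘ ι) q := d3.comp q d2
  have c1 := mfderiv_comp q d3 d2
  have c2 := mfderiv_comp_mfderivWithin_of_eq d4 d1
    (I.uniqueMDiffOn _ (mem_range_self _)) hx
  have c3 : mfderivWithin 𝓘(ℝ, E) 𝓘(ℝ, E') ((extChartAt I' (ι p) ∘ ι) ∘ (extChartAt I p).symm)
      (range I) (extChartAt I p q) = fderiv ℝ (writtenInExtChartAt I I' p ι) (extChartAt I p q) := by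
    rw [I.range_eq_univ, mfderivWithin_univ, mfderiv_eq_fderiv]
    rfl
  rw [← c3, c2, c1]
  rfl

theorem contDiffAt_writtenInExtChartAt {ι : M → M'} (hι : ContMDiff I I' ∞ ι) (p : M) :
    ContDiffAt ℝ ∞ (writtenInExtChartAt I I' p ι) (extChartAt I p p) := by
  have h := ((contMDiffAt_iff).1 (hι p)).2
  rwa [I.range_eq_univ, contDiffWithinAt_univ] at h

/-- The second derivative of `ι` in the preferred charts at `p` and `ι p`. -/
noncomputable def coordHess (I : ModelWithCorners ℝ E H) (I' : ModelWithCorners ℝ E' H')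
    (ι : M → M') (p : M) (v w : TangentSpace I p) :
    TangentSpace I' (ι p) :=
  fderiv ℝ (fderiv ℝ (writtenInExtChartAt I I' p ι)) (extChartAt I p p) v w

theorem coordHess_comm {ι : M → M'} (hι : ContMDiff I I' ∞ ι) (p : M) (v w : TangentSpace I p) :
    coordHess I I' ι p v w = coordHess I I' ι p w v :=
  (contDiffAt_writtenInExtChartAt hι p).isSymmSndFDerivAt
    (by rw [minSmoothness_of_isRCLikeNormedField]; exact WithTop.coe_le_coe.2 le_top) v w

theorem hasMFDerivAt_coordDeriv {ι : M → M'} (hι : ContMDiff I I' ∞ ι) {p : M}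
    (w : TangentSpace I p) :
    HasMFDerivAt I 𝓘(ℝ, E') (coordDeriv (I' := I') ι w : M → E') p
      ((fderiv ℝ (fderiv ℝ (writtenInExtChartAt I I' p ι)) (extChartAt I p p)).flip w) := by
  have hu := contDiffAt_writtenInExtChartAt hι p
  have h1 : DifferentiableAt ℝ (fderiv ℝ (writtenInExtChartAt I I' p ι)) (extChartAt I p p) :=
    (hu.fderiv_right (m := ∞) (by simp)).differentiableAt (by simp)
  have h2 := h1.hasFDerivAt.clm_apply (hasFDerivAt_const (w : E) (extChartAt I p p))
  erw [ContinuousLinearMap.comp_zero, zero_add] at h2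
  have h3 := (h2.hasMFDerivAt).comp p
    (mdifferentiableAt_extChartAt (I := I) (mem_chart_source H p)).hasMFDerivAt
  refine (h3.congr_of_eventuallyEq (coordDeriv_eventuallyEq hι w)).congr_mfderiv ?_
  rw [mfderiv_extChartAt_self]
  rfl

theorem mvfderiv_coordDeriv {ι : M → M'} (hι : ContMDiff I I' ∞ ι) {p : M}
    (v w : TangentSpace I p) :
    mvfderiv I (coordDeriv (I' := I') ι w : M → E') p v = coordHess I I' ι p v w := by
  rw [mvfderiv, (hasMFDerivAt_coordDeriv hι w).mfderiv]
  rfl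

theorem coordDeriv_self (ι : M → M') {p : M} (w : TangentSpace I p) :
    coordDeriv (I' := I') ι w p = mfderiv I I' ι p w := by
  rw [coordDeriv, FiberBundle.extend_apply_self]
  exact trivializationAt_self_snd (I := I') (ι p) _

/-- The derivative of the coordinates is the Hessian of `ι` in charts, which does not involve the
connection. Hence two connections differ along `ι` only in the second summand. -/
theorem covAlong_extend {ι : M → M'} (hι : ContMDiff I I' ∞ ι)
    (cov : (Π x : M', TangentSpace I' x) → (Π x : M', TangentSpace I' x →L[ℝ] TangentSpace I' x))
    {p : M} (v w : TangentSpace I p) :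
    covAlong cov ι (fun q => mfderiv I I' ι q
      (FiberBundle.extend E (E := fun x : M => TangentSpace I x) w q)) p v
      = coordHess I I' ι p v w
        + cov (FiberBundle.extend E' (mfderiv I I' ι p w)) (ι p) (mfderiv I I' ι p v) := by
  have h := mvfderiv_coordDeriv hι v w
  unfold coordDeriv at h
  simp only [covAlong, FiberBundle.extend_apply_self]
  congr 1
  rw [trivializationAt_self_symm]
  exact h

theorem mfderiv_extend_eventuallyEq {ι : M → M'} (hι : ContMDiff I I' ∞ ι) {p : M}
    (w : TangentSpace I p) :
    ∀ᶠ q in 𝓝 p, mfderiv I I' ι q (FiberBundle.extend E w q)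
      = (trivializationAt E' (TangentSpace I') (ι p)).symmL ℝ (ι q)
          (coordDeriv (I' := I') ι w q) := by
  filter_upwards [hι.continuous.continuousAt.eventually (chart_source_mem_nhds H' (ι p))]
    with q hq
  have hq' : ι q ∈ (trivializationAt E' (TangentSpace I') (ι p)).baseSet := hq
  have h := (trivializationAt E' (TangentSpace I') (ι p)).symmL_continuousLinearMapAt (R := ℝ)
    hq' (mfderiv I I' ι q (FiberBundle.extend E w q))
  rw [Trivialization.continuousLinearMapAt_apply_of_mem (R := ℝ) _ hq'] at h
  exact h.symm

end Coord

/-! ### Product rules for operator-valued functions. -/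

section ProductRule

variable {E : Type*} [NormedAddCommGroup E] [NormedSpace ℝ E]
  {H : Type*} [TopologicalSpace H] {I : ModelWithCorners ℝ E H}
  {M : Type*} [TopologicalSpace M] [ChartedSpace H M]
  {F G : Type*} [NormedAddCommGroup F] [NormedSpace ℝ F] [FiniteDimensional ℝ F]
  [NormedAddCommGroup G] [NormedSpace ℝ G]

/-- In finite dimension `B` is a finite sum of fixed linear images of its values on a basis. -/
theorem mdifferentiableAt_clm_of_apply {B : M → F →L[ℝ] G} {x : M}
    (hB : ∀ a, MDifferentiableAt I 𝓘(ℝ, G) (fun y => B y a) x) :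
    MDifferentiableAt I 𝓘(ℝ, F →L[ℝ] G) B x := by
  let b := Module.finBasis ℝ F
  let L : Fin (Module.finrank ℝ F) → G →L[ℝ] F →L[ℝ] G := fun i =>
    ContinuousLinearMap.smulRightL ℝ F G (LinearMap.toContinuousLinearMap (b.coord i))
  have h : B = ∑ i, fun y => L i (B y (b i)) := by
    funext y
    ext a
    conv_lhs => rw [← b.sum_repr a, map_sum]
    simp [L]
  rw [h]
  exact MDifferentiableAt.sum fun i _ => (L i).mdifferentiableAt.comp x (hB (b i))

omit [FiniteDimensional ℝ F] in
theorem mvfderiv_clm_apply {B : M → F →L[ℝ] G} {a : M → F} {x : M}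
    (hB : MDifferentiableAt I 𝓘(ℝ, F →L[ℝ] G) B x)
    (ha : MDifferentiableAt I 𝓘(ℝ, F) a x) (v : TangentSpace I x) :
    mvfderiv I (fun y => B y (a y)) x v
      = mvfderiv I B x v (a x) + B x (mvfderiv I a x v) := by
  have hB' := hB.hasMFDerivAt
  have ha' := ha.hasMFDerivAt
  have h : HasMFDerivAt I 𝓘(ℝ, G) (fun y => B y (a y)) x _ :=
    ⟨hB'.1.clm_apply ha'.1, hB'.2.clm_apply ha'.2⟩
  have hx : (extChartAt I x).symm (extChartAt I x x) = x := extChartAt_to_inv x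
  rw [mvfderiv, h.mfderiv]
  refine (add_comm _ _).trans ?_
  simp only [writtenInExtChartAt, extChartAt_model_space_eq_id, PartialEquiv.refl_coe,
    Function.comp_apply, id_eq, hx]
  rfl

omit [FiniteDimensional ℝ F] in
theorem mvfderiv_apply_const₂ {B : M → F →L[ℝ] F →L[ℝ] ℝ} {x : M}
    (hB : MDifferentiableAt I 𝓘(ℝ, F →L[ℝ] F →L[ℝ] ℝ) B x) (a c : F) (u : TangentSpace I x) :
    mvfderiv I B x u a c = mvfderiv I (fun y => B y a c) x u := by
  have t1 := mvfderiv_clm_apply (hB.clm_apply (mdifferentiableAt_const (c := a)))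
    (mdifferentiableAt_const (c := c)) u
  have t2 := mvfderiv_clm_apply hB (mdifferentiableAt_const (c := a)) u
  rw [mvfderiv_const, zero_apply, map_zero, add_zero] at t1 t2
  rw [← t2, ← t1]

omit [FiniteDimensional ℝ F] in
theorem mvfderiv_congr_of_eventuallyEq {f₁ f₂ : M → F} {x : M} (h : f₁ =ᶠ[𝓝 x] f₂) : mvfderiv I f₁ x = mvfderiv I f₂ x := by
  ext v
  exact congrArg (fun A => A v) (h.mfderiv_eq (I := I) (I' := 𝓘(ℝ, F)))

end ProductRule

/-! ### Differentiating a bilinear form pulled back by the immersion. -/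

section Pullback

variable {E : Type*} [NormedAddCommGroup E] [NormedSpace ℝ E]
  {H : Type*} [TopologicalSpace H] {I : ModelWithCorners ℝ E H} [I.Boundaryless]
  {M : Type*} [TopologicalSpace M] [ChartedSpace H M] [IsManifold I ∞ M]
  {E' : Type*} [NormedAddCommGroup E'] [NormedSpace ℝ E'] [FiniteDimensional ℝ E']
  {H' : Type*} [TopologicalSpace H'] {I' : ModelWithCorners ℝ E' H'}
  {M' : Type*} [TopologicalSpace M'] [ChartedSpace H' M'] [IsManifold I' ∞ M']

/-- The matrix of a field of bilinear forms in the trivialization centred at `y₀`. -/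
noncomputable def coordBilin (b : Π x : M', TangentSpace I' x →L[ℝ] TangentSpace I' x →L[ℝ] ℝ)
    (y₀ y : M') : E' →L[ℝ] E' →L[ℝ] ℝ :=
  (((trivializationAt E' (TangentSpace I') y₀).symmL ℝ y).precomp ℝ).comp
    ((b y).comp ((trivializationAt E' (TangentSpace I') y₀).symmL ℝ y))

theorem coordBilin_eventuallyEq
    (b : Π x : M', TangentSpace I' x →L[ℝ] TangentSpace I' x →L[ℝ] ℝ) {y₀ : M'}
    (a c : TangentSpace I' y₀) :
    (fun y => coordBilin b y₀ y a c) =ᶠ[𝓝 y₀]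
      fun y => b y (FiberBundle.extend E' a y) (FiberBundle.extend E' c y) := by
  filter_upwards [chart_source_mem_nhds H' y₀] with y hy
  rw [extend_eq_symmL hy, extend_eq_symmL hy]
  rfl

/-- In the trivialization at `ι p` the function is a matrix applied to two coordinate vectors.
Differentiating the matrix gives the ambient term, differentiating the vectors gives the Hessians.
The form is arbitrary so that the lemma serves both `g` and `Ω`. -/
theorem mvfderiv_pullback_bilin {ι : M → M'} (hι : ContMDiff I I' ∞ ι)
    (b : Π x : M', TangentSpace I' x →L[ℝ] TangentSpace I' x →L[ℝ] ℝ) {p : M}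
    (hb : ∀ a c : TangentSpace I' (ι p), MDifferentiableAt I' 𝓘(ℝ, ℝ)
      (fun y => b y (FiberBundle.extend E' a y) (FiberBundle.extend E' c y)) (ι p))
    (v Y Z : TangentSpace I p) :
    mvfderiv I (fun q => b (ι q) (mfderiv I I' ι q (FiberBundle.extend E Y q))
        (mfderiv I I' ι q (FiberBundle.extend E Z q))) p v
      = mvfderiv I' (fun y => b y (FiberBundle.extend E' (mfderiv I I' ι p Y) y)
          (FiberBundle.extend E' (mfderiv I I' ι p Z) y)) (ι p) (mfderiv I I' ι p v)
        + b (ι p) (coordHess I I' ι p v Y) (mfderiv I I' ι p Z)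
        + b (ι p) (mfderiv I I' ι p Y) (coordHess I I' ι p v Z) := by
  have hB : MDifferentiableAt I' 𝓘(ℝ, E' →L[ℝ] E' →L[ℝ] ℝ) (coordBilin b (ι p)) (ι p) :=
    mdifferentiableAt_clm_of_apply fun a => mdifferentiableAt_clm_of_apply fun c =>
      (hb a c).congr_of_eventuallyEq (coordBilin_eventuallyEq b a c)
  have dι : MDifferentiableAt I I' ι p := hι.mdifferentiableAt (by simp)
  have hBι : MDifferentiableAt I 𝓘(ℝ, E' →L[ℝ] E' →L[ℝ] ℝ)
      (fun q => coordBilin b (ι p) (ι q)) p := hB.comp p dι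
  have dY := (hasMFDerivAt_coordDeriv (I' := I') hι Y).mdifferentiableAt
  have dZ := (hasMFDerivAt_coordDeriv (I' := I') hι Z).mdifferentiableAt
  have e1 : (fun q => b (ι q) (mfderiv I I' ι q (FiberBundle.extend E Y q))
        (mfderiv I I' ι q (FiberBundle.extend E Z q))) =ᶠ[𝓝 p]
      fun q => coordBilin b (ι p) (ι q) (coordDeriv (I' := I') ι Y q)
        (coordDeriv (I' := I') ι Z q) := by
    filter_upwards [mfderiv_extend_eventuallyEq (I' := I') hι Y,
      mfderiv_extend_eventuallyEq (I' := I') hι Z] with q h1 h2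
    rw [h1, h2]
    rfl
  have c0 : ∀ x y : TangentSpace I' (ι p), coordBilin b (ι p) (ι p) x y = b (ι p) x y := by
    intro x y
    have := (coordBilin_eventuallyEq b (y₀ := ι p) x y).eq_of_nhds
    refine this.trans ?_
    rw [FiberBundle.extend_apply_self, FiberBundle.extend_apply_self]
  have s1 := mvfderiv_clm_apply (hBι.clm_apply dY) dZ v
  have s2 := mvfderiv_clm_apply hBι dY v
  have s3 : mvfderiv I (fun q => coordBilin b (ι p) (ι q)) p v
      = mvfderiv I' (coordBilin b (ι p)) (ι p) (mfderiv I I' ι p v) :=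
    congrArg (fun A => A v) (mfderiv_comp p hB dι)
  have s4 : ∀ x y u : TangentSpace I' (ι p),
      mvfderiv I' (coordBilin b (ι p)) (ι p) u x y
        = mvfderiv I' (fun z => b z (FiberBundle.extend E' x z)
          (FiberBundle.extend E' y z)) (ι p) u := by
    intro x y u
    refine (mvfderiv_apply_const₂ hB (x : E') (y : E') u).trans ?_
    exact congrArg (fun A => A u) (mvfderiv_congr_of_eventuallyEq
      (coordBilin_eventuallyEq b (y₀ := ι p) x y))
  rw [mvfderiv_congr_of_eventuallyEq e1, s1, s2, mvfderiv_coordDeriv hι, mvfderiv_coordDeriv hι,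
    add_apply, s3, coordDeriv_self, coordDeriv_self]
  exact congrArg₂ (· + ·) (congrArg₂ (· + ·) (s4 _ _ _) (c0 _ _)) (c0 _ _)

end Pullback

/-! ### The local Kähler connection and the Lee form. -/

section Ambient

variable {E : Type*} [NormedAddCommGroup E] [NormedSpace ℝ E]
  {H : Type*} [TopologicalSpace H] {I : ModelWithCorners ℝ E H}
  {M : Type*} [TopologicalSpace M] [ChartedSpace H M] [IsManifold I ∞ M]

theorem IsLeviCivitaOn.extend_comm
    {g : Π x : M, TangentSpace I x →L[ℝ] TangentSpace I x →L[ℝ] ℝ}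
    {cov : (Π x : M, TangentSpace I x) → (Π x : M, TangentSpace I x →L[ℝ] TangentSpace I x)}
    {U : Set M} (h : IsLeviCivitaOn g cov U) {x : M} (hx : x ∈ U) (a b : TangentSpace I x) :
    cov (FiberBundle.extend E a) x b = cov (FiberBundle.extend E b) x a := by
  have := h.torsionFree x hx _ _ (diffField_extend b) (diffField_extend a)
  rw [mlieBracket_extend, FiberBundle.extend_apply_self, FiberBundle.extend_apply_self] at this
  exact sub_eq_zero.1 this

theorem RMetric.mdifferentiableAt_apply (g : RMetric I M) {x : M}
    {Y Z : Π x : M, TangentSpace I x} (hY : DiffField I Y x) (hZ : DiffField I Z x) :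
    MDifferentiableAt I 𝓘(ℝ, ℝ) (fun y => g.inner y (Y y) (Z y)) x := by
  have h : MDifferentiableAt I (I.prod 𝓘(ℝ)) (fun y =>
      TotalSpace.mk' ℝ (E := Bundle.Trivial M ℝ) y (g.inner y (Y y) (Z y))) x := by
    apply MDifferentiableAt.clm_bundle_apply₂ (F₁ := E) (F₂ := E)
    · exact (g.contMDiff.mdifferentiable (by simp)) x
    · exact hY
    · exact hZ
  simp only [mdifferentiableAt_totalSpace] at h
  exact h.2

theorem IsComplexStructure.diffField {J : Π x : M, TangentSpace I x →L[ℝ] TangentSpace I x}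
    (hJ : IsComplexStructure J) {Y : Π x : M, TangentSpace I x} {x : M} (hY : DiffField I Y x) :
    DiffField I (fun y => J y (Y y)) x :=
  MDifferentiableAt.clm_bundle_apply (F₁ := E) (F₂ := E)
    ((hJ.smooth.mdifferentiable (by simp)) x) hY

/-- Compatibility with `e^{-φ} g`, divided by `e^{-φ}`: differentiating the conformal factor leaves
the term in `dφ`. -/
theorem IsLeviCivitaOn.mvfderiv_conformal {g : RMetric I M} {φ : M → ℝ}
    {cov : (Π x : M, TangentSpace I x) → (Π x : M, TangentSpace I x →L[ℝ] TangentSpace I x)}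
    {U : Set M} (h : IsLeviCivitaOn (fun y => Real.exp (-φ y) • g.inner y) cov U) {x : M}
    (hx : x ∈ U) (hφ : MDifferentiableAt I 𝓘(ℝ, ℝ) φ x)
    {Y Z : Π x : M, TangentSpace I x} (hY : DiffField I Y x) (hZ : DiffField I Z x)
    (v : TangentSpace I x) :
    mvfderiv I (fun y => g.inner y (Y y) (Z y)) x v
      = mvfderiv I φ x v * g.inner x (Y x) (Z x)
        + g.inner x (cov Y x v) (Z x) + g.inner x (Y x) (cov Z x v) := by
  have h1 := h.metric x hx Y Z hY hZ v
  have h2 := RMetric.mdifferentiableAt_apply g hY hZ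
  have h3 : HasMFDerivAt I 𝓘(ℝ, ℝ) (fun y => Real.exp (-φ y)) x
      (-(Real.exp (-φ x)) • mfderiv I 𝓘(ℝ, ℝ) φ x) := by
    have e : HasDerivAt (fun t : ℝ => Real.exp (-t)) (-(Real.exp (-φ x))) (φ x) := by
      simpa using (hasDerivAt_neg (φ x)).exp
    have := e.hasFDerivAt.hasMFDerivAt.comp x hφ.hasMFDerivAt
    refine this.congr_mfderiv ?_
    ext w
    exact mul_comm (show ℝ from mfderiv I 𝓘(ℝ, ℝ) φ x w) (-Real.exp (-φ x))
  have h4 : mvfderiv I (fun y => Real.exp (-φ y)) x v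
      = -(Real.exp (-φ x)) * mvfderiv I φ x v := by
    rw [mvfderiv, h3.mfderiv]
    rfl
  have h5 := congrArg (fun A => A v) (mvfderiv_fun_mul h3.mdifferentiableAt h2)
  simp only [add_apply, smul_apply, smul_eq_mul] at h1 h5
  rw [h1, h4] at h5
  have hpos : Real.exp (-φ x) ≠ 0 := (Real.exp_pos _).ne'
  apply mul_left_cancel₀ hpos
  linear_combination -h5

/-- The fundamental form as a field of continuous bilinear forms. -/
noncomputable def fundFormL (g : RMetric I M)
    (J : Π x : M, TangentSpace I x →L[ℝ] TangentSpace I x) (x : M) :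
    TangentSpace I x →L[ℝ] TangentSpace I x →L[ℝ] ℝ :=
  ((J x).precomp ℝ).comp (g.inner x)

theorem fundFormL_apply (g : RMetric I M)
    (J : Π x : M, TangentSpace I x →L[ℝ] TangentSpace I x) (x : M) (v w : TangentSpace I x) :
    fundFormL g J x v w = g.inner x v (J x w) := rfl

theorem mvfderiv_fundForm_extend {g : RMetric I M}
    {J : Π x : M, TangentSpace I x →L[ℝ] TangentSpace I x} (hJ : IsComplexStructure J) {φ : M → ℝ}
    {cov : (Π x : M, TangentSpace I x) → (Π x : M, TangentSpace I x →L[ℝ] TangentSpace I x)}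
    {U : Set M} (h : IsLeviCivitaOn (fun y => Real.exp (-φ y) • g.inner y) cov U)
    (hpar : IsParallelOn cov J U) {x : M}
    (hx : x ∈ U) (hφ : MDifferentiableAt I 𝓘(ℝ, ℝ) φ x) (a c v : TangentSpace I x) :
    mvfderiv I (fun y => g.inner y (FiberBundle.extend E a y)
        (J y (FiberBundle.extend E c y))) x v
      = mvfderiv I φ x v * g.inner x a (J x c)
        + g.inner x (cov (FiberBundle.extend E a) x v) (J x c)
        + g.inner x a (J x (cov (FiberBundle.extend E c) x v)) := by
  have := h.mvfderiv_conformal hx hφ (diffField_extend a) (hJ.diffField (diffField_extend c)) v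
  rw [hpar x hx _ (diffField_extend c)] at this
  simpa only [FiberBundle.extend_apply_self] using this

theorem IsLCK.inner_J_left {g : RMetric I M}
    {J : Π x : M, TangentSpace I x →L[ℝ] TangentSpace I x} (h : IsLCK g J) (x : M)
    (v w : TangentSpace I x) : g.inner x (J x v) w = - g.inner x v (J x w) := by
  rw [← h.hermitian x v (J x w), h.complex.sq, map_neg, neg_neg]

/-- Evaluate `dΩ = 2 α ∧ Ω` on `(a, b, Jb)`. The form `e^{-φ} Ω` is closed, so the connection terms
cancel in pairs and `dΩ` reduces to `dφ ∧ Ω`. As `a` is orthogonal to `b` and `Jb`, only the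
multiples of `Ω(b, Jb) = -g(b, b) ≠ 0` survive. -/
theorem IsLeeForm.two_mul_eq {g : RMetric I M}
    {J : Π x : M, TangentSpace I x →L[ℝ] TangentSpace I x} (hJ : IsLCK g J)
    {α : Π x : M, TangentSpace I x →L[ℝ] ℝ} (hα : IsLeeForm g J α) {φ : M → ℝ}
    {cov : (Π x : M, TangentSpace I x) → (Π x : M, TangentSpace I x →L[ℝ] TangentSpace I x)}
    {U : Set M} (h : IsLeviCivitaOn (fun y => Real.exp (-φ y) • g.inner y) cov U)
    (hpar : IsParallelOn cov J U) {x : M}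
    (hx : x ∈ U) (hφ : MDifferentiableAt I 𝓘(ℝ, ℝ) φ x) {a b : TangentSpace I x} (hb : b ≠ 0)
    (hab : g.inner x a b = 0) (hJab : g.inner x a (J x b) = 0) :
    2 * α x a = mvfderiv I φ x a := by
  have key := hα.extDeriv_fundForm x _ _ _ (smoothField_extend a) (smoothField_extend b)
    (smoothField_extend (J x b))
  simp only [extDerivTwo, fundForm, mlieBracket_extend, wedgeOneTwo, map_zero,
    FiberBundle.extend_apply_self, mvfderiv_fundForm_extend hJ.complex h hpar hx hφ,
    zero_apply, hJ.complex.sq, map_neg] at key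
  -- Each of `e1`, `e2`, `e3` matches two connection terms, using the symmetry `extend_comm` and the
  -- compatibility of `J` with `g`.
  have e1 : g.inner x (J x b) (J x (cov (FiberBundle.extend E a) x b))
      = g.inner x (cov (FiberBundle.extend E b) x a) b := by
    rw [hJ.hermitian, h.extend_comm hx a b, g.symm]
  have e2 : g.inner x b (J x (cov (FiberBundle.extend E (J x b)) x a))
      = - g.inner x (cov (FiberBundle.extend E a) x (J x b)) (J x b) := by
    rw [h.extend_comm hx a (J x b), g.symm, ← neg_neg (g.inner x _ (J x b)), ← hJ.inner_J_left]
    simp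
  have e3 : g.inner x (cov (FiberBundle.extend E (J x b)) x b) (J x a)
      = - g.inner x a (J x (cov (FiberBundle.extend E b) x (J x b))) := by
    rw [h.extend_comm hx b (J x b), ← hJ.inner_J_left, g.symm]
  have e4 : g.inner x (J x b) (J x a) = 0 := by rw [hJ.hermitian, g.symm, hab]
  rw [e1, e2, e3, e4, hJab] at key
  have hbb := g.pos x b hb
  apply mul_right_cancel₀ hbb.ne'
  linear_combination key

end Ambient

/-! ### Derivatives of the warped product metric. -/

section Warped

variable {E₁ : Type*} [NormedAddCommGroup E₁] [NormedSpace ℝ E₁]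
  {H₁ : Type*} [TopologicalSpace H₁] {I₁ : ModelWithCorners ℝ E₁ H₁} [I₁.Boundaryless]
  {N₁ : Type*} [TopologicalSpace N₁] [ChartedSpace H₁ N₁] [IsManifold I₁ ∞ N₁]
  {E₂ : Type*} [NormedAddCommGroup E₂] [NormedSpace ℝ E₂]
  {H₂ : Type*} [TopologicalSpace H₂] {I₂ : ModelWithCorners ℝ E₂ H₂} [I₂.Boundaryless]
  {N₂ : Type*} [TopologicalSpace N₂] [ChartedSpace H₂ N₂] [IsManifold I₂ ∞ N₂]

/-- In product charts the projection is the linear projection, so constant fields project to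
constant fields. Therefore an extension of a vector tangent to a factor stays tangent to it nearby.
-/
theorem mfderiv_fst_extend {p : N₁ × N₂} (w : TangentSpace (I₁.prod I₂) p) :
    ∀ᶠ q in 𝓝 p, mfderiv (I₁.prod I₂) I₁ Prod.fst q (FiberBundle.extend (E₁ × E₂) w q)
      = FiberBundle.extend E₁ (mfderiv (I₁.prod I₂) I₁ Prod.fst p w) q.1 := by
  have hfst : ContMDiff (I₁.prod I₂) I₁ ∞ (Prod.fst : N₁ × N₂ → N₁) := contMDiff_fst
  have hw : (writtenInExtChartAt (I₁.prod I₂) I₁ p Prod.fst) =ᶠ[𝓝 (extChartAt (I₁.prod I₂) p p)]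
      Prod.fst := by
    filter_upwards [extChartAt_target_mem_nhds (I := I₁.prod I₂) p] with z hz
    rw [extChartAt_prod] at hz
    simp only [writtenInExtChartAt, extChartAt_prod, Function.comp_apply, PartialEquiv.prod_symm,
      PartialEquiv.prod_coe]
    exact (extChartAt I₁ p.1).right_inv hz.1
  have hev := (continuousAt_extChartAt (I := I₁.prod I₂) p).eventually hw.eventually_nhds
  have hs : ∀ᶠ q : N₁ × N₂ in 𝓝 p, q.1 ∈ (chartAt H₁ p.1).source :=
    continuous_fst.continuousAt.eventually (chart_source_mem_nhds H₁ p.1)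
  filter_upwards [mfderiv_extend_eventuallyEq hfst w, coordDeriv_eventuallyEq hfst w, hev, hs]
    with q h1 h2 h3 h4
  rw [h1, h2, extend_eq_symmL h4, Filter.EventuallyEq.fderiv_eq (𝕜 := ℝ) h3, fderiv_fst, mfderiv_fst]
  rfl

theorem mfderiv_snd_extend {p : N₁ × N₂} (w : TangentSpace (I₁.prod I₂) p) :
    ∀ᶠ q in 𝓝 p, mfderiv (I₁.prod I₂) I₂ Prod.snd q (FiberBundle.extend (E₁ × E₂) w q)
      = FiberBundle.extend E₂ (mfderiv (I₁.prod I₂) I₂ Prod.snd p w) q.2 := by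
  have hsnd : ContMDiff (I₁.prod I₂) I₂ ∞ (Prod.snd : N₁ × N₂ → N₂) := contMDiff_snd
  have hw : (writtenInExtChartAt (I₁.prod I₂) I₂ p Prod.snd) =ᶠ[𝓝 (extChartAt (I₁.prod I₂) p p)]
      Prod.snd := by
    filter_upwards [extChartAt_target_mem_nhds (I := I₁.prod I₂) p] with z hz
    rw [extChartAt_prod] at hz
    simp only [writtenInExtChartAt, extChartAt_prod, Function.comp_apply, PartialEquiv.prod_symm,
      PartialEquiv.prod_coe]
    exact (extChartAt I₂ p.2).right_inv hz.2
  have hev := (continuousAt_extChartAt (I := I₁.prod I₂) p).eventually hw.eventually_nhds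
  have hs : ∀ᶠ q : N₁ × N₂ in 𝓝 p, q.2 ∈ (chartAt H₂ p.2).source :=
    continuous_snd.continuousAt.eventually (chart_source_mem_nhds H₂ p.2)
  filter_upwards [mfderiv_extend_eventuallyEq hsnd w, coordDeriv_eventuallyEq hsnd w, hev, hs]
    with q h1 h2 h3 h4
  rw [h1, h2, extend_eq_symmL h4, Filter.EventuallyEq.fderiv_eq (𝕜 := ℝ) h3, fderiv_snd, mfderiv_snd]
  rfl

theorem extend_zero {E : Type*} [NormedAddCommGroup E] [NormedSpace ℝ E]
    {H : Type*} [TopologicalSpace H] {I : ModelWithCorners ℝ E H}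
    {M : Type*} [TopologicalSpace M] [ChartedSpace H M] [IsManifold I ∞ M] {x : M} :
    ∀ᶠ y in 𝓝 x, FiberBundle.extend E (0 : TangentSpace I x) y = 0 := by
  filter_upwards [chart_source_mem_nhds H x] with y hy
  rw [extend_eq_symmL hy]
  exact map_zero _

theorem extend_mem_firstFactor {p : N₁ × N₂} {w : TangentSpace (I₁.prod I₂) p}
    (hw : w ∈ firstFactor I₁ I₂ p) :
    ∀ᶠ q in 𝓝 p, FiberBundle.extend (E₁ × E₂) w q ∈ firstFactor I₁ I₂ q := by
  have hw' : mfderiv (I₁.prod I₂) I₂ Prod.snd p w = 0 := hw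
  filter_upwards [mfderiv_snd_extend w, continuous_snd.continuousAt.eventually
    (extend_zero (I := I₂) (x := p.2))] with q h1 h2
  change mfderiv (I₁.prod I₂) I₂ Prod.snd q _ = 0
  rw [h1, hw', h2]

theorem extend_mem_secondFactor {p : N₁ × N₂} {w : TangentSpace (I₁.prod I₂) p}
    (hw : w ∈ secondFactor I₁ I₂ p) :
    ∀ᶠ q in 𝓝 p, FiberBundle.extend (E₁ × E₂) w q ∈ secondFactor I₁ I₂ q := by
  have hw' : mfderiv (I₁.prod I₂) I₁ Prod.fst p w = 0 := hw
  filter_upwards [mfderiv_fst_extend w, continuous_fst.continuousAt.eventually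
    (extend_zero (I := I₁) (x := p.1))] with q h1 h2
  change mfderiv (I₁.prod I₂) I₁ Prod.fst q _ = 0
  rw [h1, hw', h2]

theorem warpedMetric_mixed (g₁ : RMetric I₁ N₁) (g₂ : RMetric I₂ N₂) (f : N₁ → ℝ) {p : N₁ × N₂}
    {X Z : TangentSpace (I₁.prod I₂) p} (hX : X ∈ firstFactor I₁ I₂ p)
    (hZ : Z ∈ secondFactor I₁ I₂ p) : warpedMetric g₁ g₂ f p X Z = 0 := by
  have hX' : mfderiv (I₁.prod I₂) I₂ Prod.snd p X = 0 := hX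
  have hZ' : mfderiv (I₁.prod I₂) I₁ Prod.fst p Z = 0 := hZ
  simp only [warpedMetric, hX', hZ', map_zero, zero_apply, mul_zero, add_zero]

theorem warpedMetric_pos (g₁ : RMetric I₁ N₁) (g₂ : RMetric I₂ N₂) {f : N₁ → ℝ}
    (hf : ∀ a, 0 < f a) (p : N₁ × N₂) {X : TangentSpace (I₁.prod I₂) p} (hX : X ≠ 0) :
    0 < warpedMetric g₁ g₂ f p X X := by
  have hf2 : 0 < f p.1 ^ 2 := pow_pos (hf _) 2
  have n1 : 0 ≤ g₁.inner p.1 (mfderiv (I₁.prod I₂) I₁ Prod.fst p X)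
      (mfderiv (I₁.prod I₂) I₁ Prod.fst p X) := by
    by_cases h : mfderiv (I₁.prod I₂) I₁ Prod.fst p X = 0
    · rw [h, map_zero]
    · exact (g₁.pos _ _ h).le
  by_cases h : mfderiv (I₁.prod I₂) I₂ Prod.snd p X = 0
  · have h1 : mfderiv (I₁.prod I₂) I₁ Prod.fst p X ≠ 0 := by
      intro h1
      rw [mfderiv_fst] at h1
      rw [mfderiv_snd] at h
      exact hX (Prod.ext h1 h)
    simpa only [warpedMetric, h, map_zero, mul_zero, add_zero] using g₁.pos _ _ h1
  · exact add_pos_of_nonneg_of_pos n1 (mul_pos hf2 (g₂.pos _ _ h))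

theorem firstFactor_ne_bot [Nontrivial E₁] (p : N₁ × N₂) :
    ∃ X ∈ firstFactor I₁ I₂ p, X ≠ 0 := by
  obtain ⟨e, he⟩ := exists_ne (0 : E₁)
  refine ⟨((e, 0) : E₁ × E₂), ?_, ?_⟩
  · change mfderiv (I₁.prod I₂) I₂ Prod.snd p _ = 0
    rw [mfderiv_snd]
    rfl
  · intro h
    exact he (congrArg (Prod.fst : E₁ × E₂ → E₁) h)

theorem mvfderiv_warpedMetric_mixed (g₁ : RMetric I₁ N₁) (g₂ : RMetric I₂ N₂) (f : N₁ → ℝ)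
    {p : N₁ × N₂} {X Z : TangentSpace (I₁.prod I₂) p} (hX : X ∈ firstFactor I₁ I₂ p)
    (hZ : Z ∈ secondFactor I₁ I₂ p) (v : TangentSpace (I₁.prod I₂) p) :
    mvfderiv (I₁.prod I₂) (fun q => warpedMetric g₁ g₂ f q (FiberBundle.extend (E₁ × E₂) X q)
      (FiberBundle.extend (E₁ × E₂) Z q)) p v = 0 := by
  have h : (fun q => warpedMetric g₁ g₂ f q (FiberBundle.extend (E₁ × E₂) X q)
      (FiberBundle.extend (E₁ × E₂) Z q)) =ᶠ[𝓝 p] fun _ => (0 : ℝ) := by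
    filter_upwards [extend_mem_firstFactor hX, extend_mem_secondFactor hZ] with q h1 h2
    exact warpedMetric_mixed g₁ g₂ f h1 h2
  rw [mvfderiv_congr_of_eventuallyEq h, mvfderiv_const]
  rfl

/-- Near `p` the function factors through the first projection, whose derivative kills `v`. -/
theorem mvfderiv_warpedMetric_first (g₁ : RMetric I₁ N₁) (g₂ : RMetric I₂ N₂) (f : N₁ → ℝ)
    {p : N₁ × N₂} {X Y v : TangentSpace (I₁.prod I₂) p} (hX : X ∈ firstFactor I₁ I₂ p)
    (hv : v ∈ secondFactor I₁ I₂ p) :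
    mvfderiv (I₁.prod I₂) (fun q => warpedMetric g₁ g₂ f q (FiberBundle.extend (E₁ × E₂) X q)
      (FiberBundle.extend (E₁ × E₂) Y q)) p v = 0 := by
  let X' := mfderiv (I₁.prod I₂) I₁ Prod.fst p X
  let Y' := mfderiv (I₁.prod I₂) I₁ Prod.fst p Y
  have h : (fun q => warpedMetric g₁ g₂ f q (FiberBundle.extend (E₁ × E₂) X q)
      (FiberBundle.extend (E₁ × E₂) Y q)) =ᶠ[𝓝 p]
      (fun y => g₁.inner y (FiberBundle.extend E₁ X' y) (FiberBundle.extend E₁ Y' y))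
        ∘ Prod.fst := by
    filter_upwards [extend_mem_firstFactor hX, mfderiv_fst_extend X, mfderiv_fst_extend Y]
      with q h1 h2 h3
    have h1' : mfderiv (I₁.prod I₂) I₂ Prod.snd q (FiberBundle.extend (E₁ × E₂) X q) = 0 := h1
    simp only [warpedMetric, h1', h2, h3, map_zero, zero_apply, mul_zero, add_zero]
    rfl
  have hd := RMetric.mdifferentiableAt_apply g₁ (diffField_extend X') (diffField_extend Y')
  have hv' : mfderiv (I₁.prod I₂) I₁ Prod.fst p v = 0 := hv
  rw [mvfderiv_congr_of_eventuallyEq h, mvfderiv_comp p hd mdifferentiableAt_fst,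
    ContinuousLinearMap.comp_apply, hv', map_zero]

/-- Writing `f² = exp (2 log f)`, the function is this factor times a function of the second
coordinate; along `v` only the first factor varies. -/
theorem mvfderiv_warpedMetric_second (g₁ : RMetric I₁ N₁) (g₂ : RMetric I₂ N₂) {f : N₁ → ℝ}
    (hf : ContMDiff I₁ 𝓘(ℝ, ℝ) ∞ f) (hpos : ∀ a, 0 < f a)
    {p : N₁ × N₂} {Z W v : TangentSpace (I₁.prod I₂) p} (hZ : Z ∈ secondFactor I₁ I₂ p)
    (hv : v ∈ firstFactor I₁ I₂ p) :
    mvfderiv (I₁.prod I₂) (fun q => warpedMetric g₁ g₂ f q (FiberBundle.extend (E₁ × E₂) Z q)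
      (FiberBundle.extend (E₁ × E₂) W q)) p v
      = 2 * mvfderiv (I₁.prod I₂) (fun q : N₁ × N₂ => Real.log (f q.1)) p v
        * warpedMetric g₁ g₂ f p Z W := by
  let Z' := mfderiv (I₁.prod I₂) I₂ Prod.snd p Z
  let W' := mfderiv (I₁.prod I₂) I₂ Prod.snd p W
  let b : N₂ → ℝ := fun y => g₂.inner y (FiberBundle.extend E₂ Z' y) (FiberBundle.extend E₂ W' y)
  let F : N₁ × N₂ → ℝ := fun q => Real.log (f q.1)
  have hdb : MDifferentiableAt I₂ 𝓘(ℝ, ℝ) b p.2 :=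
    RMetric.mdifferentiableAt_apply g₂ (diffField_extend Z') (diffField_extend W')
  have hdF : MDifferentiableAt (I₁.prod I₂) 𝓘(ℝ, ℝ) F p := by
    have h1 : MDifferentiableAt (I₁.prod I₂) 𝓘(ℝ, ℝ) (fun q : N₁ × N₂ => f q.1) p :=
      (hf.mdifferentiableAt (by simp)).comp p mdifferentiableAt_fst
    exact DifferentiableAt.comp_mdifferentiableAt (g := Real.log)
      (f := fun q : N₁ × N₂ => f q.1) (Real.differentiableAt_log (hpos p.1).ne') h1
  have hde : MDifferentiableAt (I₁.prod I₂) 𝓘(ℝ, ℝ) (fun q => Real.exp (2 * F q)) p := by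
    have : DifferentiableAt ℝ (fun t => Real.exp (2 * t)) (F p) := by fun_prop
    exact this.comp_mdifferentiableAt hdF
  have hee : mvfderiv (I₁.prod I₂) (fun q => Real.exp (2 * F q)) p v
      = 2 * Real.exp (2 * F p) * mvfderiv (I₁.prod I₂) F p v := by
    have e : HasDerivAt (fun t => Real.exp (2 * t)) (2 * Real.exp (2 * F p)) (F p) := by
      have := ((hasDerivAt_id (F p)).const_mul 2).exp
      simpa [mul_comm] using this
    have h2 := e.hasFDerivAt.hasMFDerivAt.comp p hdF.hasMFDerivAt
    have h3 : mfderiv (I₁.prod I₂) 𝓘(ℝ, ℝ) (fun q => Real.exp (2 * F q)) p = _ := h2.mfderiv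
    rw [mvfderiv, h3]
    exact mul_comm (show ℝ from mfderiv (I₁.prod I₂) 𝓘(ℝ, ℝ) F p v) (2 * Real.exp (2 * F p))
  have hexp : ∀ q : N₁ × N₂, Real.exp (2 * F q) = f q.1 ^ 2 := by
    intro q
    rw [mul_comm, ← Real.exp_log (hpos q.1), ← Real.exp_nat_mul, mul_comm]
    simp [F]
  have h : (fun q => warpedMetric g₁ g₂ f q (FiberBundle.extend (E₁ × E₂) Z q)
      (FiberBundle.extend (E₁ × E₂) W q)) =ᶠ[𝓝 p] fun q => Real.exp (2 * F q) * (b ∘ Prod.snd) q := by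
    filter_upwards [extend_mem_secondFactor hZ, mfderiv_snd_extend Z, mfderiv_snd_extend W]
      with q h1 h2 h3
    have h1' : mfderiv (I₁.prod I₂) I₁ Prod.fst q (FiberBundle.extend (E₁ × E₂) Z q) = 0 := h1
    simp only [warpedMetric, h1', h2, h3, map_zero, zero_apply, zero_add, hexp]
    rfl
  have hdb' : MDifferentiableAt (I₁.prod I₂) 𝓘(ℝ, ℝ) (b ∘ Prod.snd) p :=
    hdb.comp p mdifferentiableAt_snd
  have hv' : mfderiv (I₁.prod I₂) I₂ Prod.snd p v = 0 := hv
  have hw : warpedMetric g₁ g₂ f p Z W = Real.exp (2 * F p) * (b ∘ Prod.snd) p := by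
    have := h.eq_of_nhds
    simpa only [FiberBundle.extend_apply_self] using this
  rw [mvfderiv_congr_of_eventuallyEq h, mvfderiv_fun_mul hde hdb', hw]
  simp only [add_apply, smul_apply, smul_eq_mul, hee, mvfderiv_comp p hdb mdifferentiableAt_snd,
    ContinuousLinearMap.comp_apply, hv', map_zero]
  ring

end Warped

/-! ### The linear algebra at one point. -/

section PointwiseAlgebra

variable {V T : Type*} [AddCommGroup V] [Module ℝ V] [TopologicalSpace V]
  [AddCommGroup T] [Module ℝ T] [TopologicalSpace T]
  {g : T →L[ℝ] T →L[ℝ] ℝ} {L : V →L[ℝ] T} {D : V → V →L[ℝ] T} {A B : Submodule ℝ V}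
  {K : V → V → V → ℝ}

/-- Here `L` plays the role of `dι`, `D w v` of `∇_v (dι w)`, `K v Y Z` of `v(g(Y, Z))`, and `A`,
`B` of the two distributions. The combination `K X Y Z + K Y X Z - K Z X Y` is twice the left side,
and all three terms vanish. -/
theorem koszul_first (hg : ∀ a b, g a b = g b a) (hD : ∀ v w, D v w = D w v)
    (hK : ∀ v Y Z, K v Y Z = g (D Y v) (L Z) + g (L Y) (D Z v))
    (hmix : ∀ v, ∀ X ∈ A, ∀ Z ∈ B, K v X Z = 0)
    (hfirst : ∀ v ∈ B, ∀ X ∈ A, ∀ Y ∈ A, K v X Y = 0)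
    {X Y Z : V} (hX : X ∈ A) (hY : Y ∈ A) (hZ : Z ∈ B) : g (D X Y) (L Z) = 0 := by
  have h1 := hmix X Y hY Z hZ
  have h2 := hmix Y X hX Z hZ
  have h3 := hfirst Z hZ X hX Y hY
  rw [hK] at h1 h2 h3
  rw [hD Y X] at h1
  rw [hD X Z, hg (D Z X)] at h3
  rw [hD Z Y] at h2
  rw [hD Z X, hD X Z] at h1
  linarith [hD Z X, hD Y Z, congrArg (g (L X)) (hD Y Z), congrArg (g (L Y)) (hD X Z)]

/-- The two mixed derivatives make the left side symmetric in `Z` and `W`; the derivative of `g(Z,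
W)` along `X` is then twice it. -/
theorem koszul_second (hg : ∀ a b, g a b = g b a) (hD : ∀ v w, D v w = D w v)
    (hK : ∀ v Y Z, K v Y Z = g (D Y v) (L Z) + g (L Y) (D Z v))
    (hmix : ∀ v, ∀ X ∈ A, ∀ Z ∈ B, K v X Z = 0) {l : V → ℝ}
    (hsecond : ∀ v ∈ A, ∀ Z ∈ B, ∀ W ∈ B, K v Z W = 2 * l v * g (L Z) (L W))
    {X Z W : V} (hX : X ∈ A) (hZ : Z ∈ B) (hW : W ∈ B) :
    g (D X Z) (L W) = l X * g (L Z) (L W) := by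
  have h1 := hmix Z X hX W hW
  have h2 := hmix W X hX Z hZ
  have h3 := hsecond X hX Z hZ W hW
  rw [hK] at h1 h2 h3
  rw [hD W Z] at h1
  rw [hD Z X, hD W X, hg (L Z)] at h3
  linarith

theorem koszul_second' (hg : ∀ a b, g a b = g b a) (hD : ∀ v w, D v w = D w v)
    (hK : ∀ v Y Z, K v Y Z = g (D Y v) (L Z) + g (L Y) (D Z v))
    (hmix : ∀ v, ∀ X ∈ A, ∀ Z ∈ B, K v X Z = 0) {l : V → ℝ}
    (hsecond : ∀ v ∈ A, ∀ Z ∈ B, ∀ W ∈ B, K v Z W = 2 * l v * g (L Z) (L W))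
    {X Z W : V} (hX : X ∈ A) (hZ : Z ∈ B) (hW : W ∈ B) :
    g (L X) (D Z W) = - (l X * g (L W) (L Z)) := by
  have h1 := hmix W X hX Z hZ
  rw [hK, koszul_second hg hD hK hmix hsecond hX hW hZ] at h1
  linarith

variable {J : T →L[ℝ] T} {α δ : T →L[ℝ] ℝ} {D' S : V → V → T}

/-- The component of the second fundamental form along `J (L Z)` in terms of the intrinsic
connection and of the Lee form. -/
theorem inner_J_of_lck (hg : ∀ a b, g a b = g b a) (hD : ∀ v w, D v w = D w v)
    (hinj : ∀ v, L v = 0 → v = 0)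
    (hJJ : ∀ a, J (J a) = -a) (hgJ : ∀ a b, g (J a) b = - g a (J b))
    (hperp : ∀ X ∈ A, ∀ Z ∈ B, g (L X) (L Z) = 0)
    (hΩ : ∀ X ∈ A, ∀ Z ∈ B, g (L X) (J (L Z)) = 0)
    (hA : ∃ X ∈ A, X ≠ 0)
    (hS : ∀ v w c, g (S v w) c = -(δ (L v) * g (L w) c + δ (L w) * g (L v) c
      - δ c * g (L v) (L w)) / 2)
    (hparallel : ∀ v, ∀ Y ∈ A, ∀ Z ∈ B,
      g (D Y v + S v Y) (J (L Z)) = g (J (L Y)) (D Z v + S v Z))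
    (hδ : ∀ a b, b ≠ 0 → g a b = 0 → g a (J b) = 0 → 2 * α a = δ a)
    (v : V) {Y Z : V} (hY : Y ∈ A) (hZ : Z ∈ B) :
    g (D Y v) (J (L Z)) = α (L Y) * g (L v) (J (L Z)) - α (J (L Z)) * g (L v) (L Y)
      + g (J (L Y)) (D Z v) - α (L Z) * g (L v) (J (L Y)) + α (J (L Y)) * g (L v) (L Z) := by
  by_cases hZ0 : Z = 0
  · have : D (0 : V) v = 0 := by rw [hD, map_zero]
    simp [hZ0, this]
  obtain ⟨X, hX, hX0⟩ := hA
  have hLZ : L Z ≠ 0 := fun h => hZ0 (hinj Z h)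
  have hLX : L X ≠ 0 := fun h => hX0 (hinj X h)
  have hΩ' : ∀ X ∈ A, g (L Z) (J (L X)) = 0 := by
    intro X hX
    have := hΩ X hX Z hZ
    rw [hg, hgJ] at this
    linarith
  -- `LY` and `JLY` are orthogonal to the complex line of `LZ`; `LZ` and `JLZ` to that of `LX`. This
  -- is why a nonzero `X` in `A` and `Z ≠ 0` are needed.
  have d1 := hδ (L Y) (L Z) hLZ (hperp Y hY Z hZ) (hΩ Y hY Z hZ)
  have d2 := hδ (L Z) (L X) hLX (by rw [hg, hperp X hX Z hZ]) (hΩ' X hX)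
  have d3 := hδ (J (L Z)) (L X) hLX (by rw [hg, hΩ X hX Z hZ])
    (by rw [hgJ, hJJ, map_neg, neg_neg, hg, hperp X hX Z hZ])
  have d4 := hδ (J (L Y)) (L Z) hLZ (by rw [hg, hΩ' Y hY])
    (by rw [hgJ, hJJ, map_neg, neg_neg, hperp Y hY Z hZ])
  have h := hparallel v Y hY Z hZ
  rw [map_add, add_apply, map_add, hS, hg (J (L Y)) (S v Z), hS, hΩ Y hY Z hZ, hΩ' Y hY,
    ← d1, ← d2, ← d3, ← d4] at h
  linarith

/-- For `X ≠ 0` in `A`, `kJ` evaluates `g(D X (PX), JZ)` as `-α(Z) |X|²` and `g(D (PX) X, JZ)` as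
`α(Z) |X|²`. Symmetry of `D` makes them equal. -/
theorem lee_eq_zero_on_second (hg : ∀ a b, g a b = g b a) (hD : ∀ v w, D v w = D w v)
    (hpos : ∀ v, v ≠ 0 → 0 < g (L v) (L v))
    (hJJ : ∀ a, J (J a) = -a) (hgJ : ∀ a b, g (J a) b = - g a (J b))
    (hperp : ∀ X ∈ A, ∀ Z ∈ B, g (L X) (L Z) = 0)
    (hΩ : ∀ X ∈ A, ∀ Z ∈ B, g (L X) (J (L Z)) = 0)
    (hA : ∃ X ∈ A, X ≠ 0)
    {P : V → V} (hPA : ∀ X ∈ A, P X ∈ A) (hPAJ : ∀ X ∈ A, J (L X) = L (P X))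
    (k1' : ∀ X ∈ A, ∀ Y ∈ A, ∀ Z ∈ B, g (L Y) (D Z X) = 0)
    (kJ : ∀ v, ∀ Y ∈ A, ∀ Z ∈ B, g (D Y v) (J (L Z)) = α (L Y) * g (L v) (J (L Z))
      - α (J (L Z)) * g (L v) (L Y) + g (J (L Y)) (D Z v) - α (L Z) * g (L v) (J (L Y))
      + α (J (L Y)) * g (L v) (L Z))
    {Z : V} (hZ : Z ∈ B) : α (L Z) = 0 := by
  obtain ⟨X, hX, hX0⟩ := hA
  have h1 := kJ (P X) X hX Z hZ
  have h2 := kJ X (P X) (hPA X hX) Z hZ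
  rw [hΩ _ (hPA X hX) Z hZ, hperp _ (hPA X hX) Z hZ, hPAJ X hX,
    k1' _ (hPA X hX) _ (hPA X hX) Z hZ] at h1
  rw [hΩ _ hX Z hZ, hperp _ hX Z hZ, hPAJ _ (hPA X hX), k1' X hX _ (hPA _ (hPA X hX)) Z hZ,
    ← hPAJ _ (hPA X hX), ← hPAJ X hX, hJJ, map_neg, hD, hg (L X) (J (L X)), hPAJ X hX] at h2
  rw [hg (L (P X)) (L X)] at h1
  have h4 : g (L X) (L (P X)) = 0 := by
    rw [← hPAJ X hX]
    have := hgJ (L X) (L X)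
    rw [hg] at this
    linarith
  rw [hg (L (P X)) (L X), h4] at h2
  rw [h4] at h1
  have h5 : g (L (P X)) (L (P X)) = g (L X) (L X) := by
    rw [← hPAJ X hX, hgJ, hJJ, map_neg, neg_neg]
  rw [h5] at h1
  have h6 : α (L Z) * g (L X) (L X) = 0 := by linarith
  exact (mul_eq_zero.1 h6).resolve_right (hpos X hX0).ne'

/-- The component of the second fundamental form along `F Z = J (L Z) - L (P Z)`. -/
theorem inner_normal_eq_zero (hg : ∀ a b, g a b = g b a)
    (hperp : ∀ X ∈ A, ∀ Z ∈ B, g (L X) (L Z) = 0)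
    (hΩ : ∀ X ∈ A, ∀ Z ∈ B, g (L X) (J (L Z)) = 0)
    {P : V → V} (hPA : ∀ X ∈ A, P X ∈ A) (hPAJ : ∀ X ∈ A, J (L X) = L (P X))
    (hPB : ∀ Z ∈ B, P Z ∈ B) (hP : ∀ v w, g (J (L v)) (L w) = g (L (P v)) (L w))
    {ℓ : V} (hℓ : ∀ u, α u = g (L ℓ) u)
    (k1 : ∀ X ∈ A, ∀ Y ∈ A, ∀ Z ∈ B, g (D X Y) (L Z) = 0)
    (k1' : ∀ X ∈ A, ∀ Y ∈ A, ∀ Z ∈ B, g (L Y) (D Z X) = 0)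
    (kJ : ∀ v, ∀ Y ∈ A, ∀ Z ∈ B, g (D Y v) (J (L Z)) = α (L Y) * g (L v) (J (L Z))
      - α (J (L Z)) * g (L v) (L Y) + g (J (L Y)) (D Z v) - α (L Z) * g (L v) (J (L Y))
      + α (J (L Y)) * g (L v) (L Z))
    (hαB : ∀ Z ∈ B, α (L Z) = 0)
    {X Y Z : V} (hX : X ∈ A) (hY : Y ∈ A) (hZ : Z ∈ B) :
    g (D Y X) (J (L Z) - L (P Z)) = 0 := by
  -- Tangency of the Lee vector: `α(JZ)` sees only the tangential part `PZ`, which lies in `B`.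
  have hαJ : α (J (L Z)) = 0 := by
    rw [hℓ, hg, hP, hg, ← hℓ, hαB _ (hPB Z hZ)]
  rw [map_sub, k1 Y hY X hX _ (hPB Z hZ), kJ X Y hY Z hZ, hΩ X hX Z hZ, hperp X hX Z hZ, hαJ,
    hαB Z hZ, hPAJ Y hY, k1' X hX _ (hPA Y hY) Z hZ]
  ring

theorem inner_normal_mixed (hg : ∀ a b, g a b = g b a)
    {P : V → V} (hPA : ∀ X ∈ A, P X ∈ A) (hPAJ : ∀ X ∈ A, J (L X) = L (P X))
    (hPB : ∀ Z ∈ B, P Z ∈ B) (hP : ∀ v w, g (J (L v)) (L w) = g (L (P v)) (L w))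
    {ℓ : V} (hℓ : ∀ u, α u = g (L ℓ) u) {l : V → ℝ}
    (k2 : ∀ X ∈ A, ∀ Z ∈ B, ∀ W ∈ B, g (D X Z) (L W) = l X * g (L Z) (L W))
    (k3 : ∀ X ∈ A, ∀ Z ∈ B, ∀ W ∈ B, g (L X) (D Z W) = -(l X * g (L W) (L Z)))
    (kJ : ∀ v, ∀ Y ∈ A, ∀ Z ∈ B, g (D Y v) (J (L Z)) = α (L Y) * g (L v) (J (L Z))
      - α (J (L Z)) * g (L v) (L Y) + g (J (L Y)) (D Z v) - α (L Z) * g (L v) (J (L Y))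
      + α (J (L Y)) * g (L v) (L Z))
    (hαB : ∀ Z ∈ B, α (L Z) = 0)
    {X Z W : V} (hX : X ∈ A) (hZ : Z ∈ B) (hW : W ∈ B) :
    g (D X W) (J (L Z) - L (P Z)) = (α (L X) - l X) * g (L W) (L (P Z))
      + (α (L (P X)) - l (P X)) * g (L W) (L Z) := by
  have hαJ : α (J (L Z)) = 0 := by
    rw [hℓ, hg, hP, hg, ← hℓ, hαB _ (hPB Z hZ)]
  rw [map_sub, k2 X hX W hW _ (hPB Z hZ), kJ W X hX Z hZ, hαJ, hαB Z hZ, hPAJ X hX,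
    k3 _ (hPA X hX) Z hZ W hW, hg (L W) (J (L Z)), hP, hg (L (P Z))]
  ring

/-- Apply `h` at `(PX, Z)` and at `(X, PZ)`. The terms in `g(W, PZ)` cancel; `P² X = -X` and `g(W,
P² Z) = -c g(Z, W)` turn the rest into the factor `1 - c`. -/
theorem inner_normal_mixed_sub (hg : ∀ a b, g a b = g b a)
    (hpos : ∀ v, v ≠ 0 → 0 < g (L v) (L v))
    (hJJ : ∀ a, J (J a) = -a) (hgJ : ∀ a b, g (J a) b = - g a (J b))
    {P : V → V} (hPA : ∀ X ∈ A, P X ∈ A) (hPAJ : ∀ X ∈ A, J (L X) = L (P X))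
    (hPB : ∀ Z ∈ B, P Z ∈ B) (hP : ∀ v w, g (J (L v)) (L w) = g (L (P v)) (L w))
    {l : V →L[ℝ] ℝ} {c : ℝ}
    (hslant : ∀ Z ∈ B, ∀ W ∈ B, g (L (P Z)) (L (P W)) = c * g (L Z) (L W))
    (h : ∀ X ∈ A, ∀ Z ∈ B, ∀ W ∈ B,
      g (D X W) (J (L Z) - L (P Z)) = (α (L X) - l X) * g (L W) (L (P Z))
        + (α (L (P X)) - l (P X)) * g (L W) (L Z))
    {X Z W : V} (hX : X ∈ A) (hZ : Z ∈ B) (hW : W ∈ B) :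
    g (D (P X) W) (J (L Z) - L (P Z)) - g (D X W) (J (L (P Z)) - L (P (P Z)))
      = (1 - c) * (l X - α (L X)) * g (L Z) (L W) := by
  have hPPX : P (P X) = -X := by
    by_contra hne
    have h1 : L (P (P X) + X) = 0 := by
      rw [map_add, ← hPAJ _ (hPA X hX), ← hPAJ X hX, hJJ]
      exact neg_add_cancel _
    have h2 := hpos (P (P X) + X) (fun h0 => hne (eq_neg_of_add_eq_zero_left h0))
    rw [h1, map_zero] at h2
    exact lt_irrefl _ h2
  have hPPZ : g (L W) (L (P (P Z))) = - (c * g (L Z) (L W)) := by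
    rw [hg, ← hP, hgJ, hg, hP, hslant W hW Z hZ, hg (L W)]
  rw [h _ (hPA X hX) Z hZ W hW, h X hX _ (hPB Z hZ) W hW, hPPX, hPPZ, map_neg, map_neg, map_neg,
    hg (L W) (L Z)]
  ring

end PointwiseAlgebra

/-! ### Tangential and normal parts, the slant condition, the shape operator. -/

section Submanifold

variable {E : Type*} [NormedAddCommGroup E] [NormedSpace ℝ E] [FiniteDimensional ℝ E]
  {H : Type*} [TopologicalSpace H] {I : ModelWithCorners ℝ E H}
  {M : Type*} [TopologicalSpace M] [ChartedSpace H M] [IsManifold I ∞ M]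
  {E' : Type*} [NormedAddCommGroup E'] [NormedSpace ℝ E']
  {H' : Type*} [TopologicalSpace H'] {I' : ModelWithCorners ℝ E' H'}
  {M' : Type*} [TopologicalSpace M'] [ChartedSpace H' M'] [IsManifold I' ∞ M']

instance finiteDimensional_tangentSpace (p : M) : FiniteDimensional ℝ (TangentSpace I p) :=
  inferInstanceAs (FiniteDimensional ℝ E)

/-- The induced metric as a bilinear map. -/
noncomputable def inducedBilin (g : RMetric I' M') (ι : M → M') (p : M) :
    TangentSpace I p →ₗ[ℝ] TangentSpace I p →ₗ[ℝ] ℝ :=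
  LinearMap.mk₂ ℝ (inducedMetric g ι p) (by simp [inducedMetric]) (by simp [inducedMetric])
    (by simp [inducedMetric]) (by simp [inducedMetric])

variable {g : RMetric I' M'} {ι : M → M'} {p : M}

theorem inducedMetric_comm (v w : TangentSpace I p) :
    inducedMetric g ι p v w = inducedMetric g ι p w v := g.symm _ _ _

theorem inner_tangentialPart (hpos : ∀ v : TangentSpace I p, v ≠ 0 → 0 < inducedMetric g ι p v v)
    (u : TangentSpace I' (ι p)) (w : TangentSpace I p) :
    g.inner (ι p) (mfderiv I I' ι p (tangentialPart g ι p u)) (mfderiv I I' ι p w)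
      = g.inner (ι p) u (mfderiv I I' ι p w) :=
  sharp_spec (inducedBilin g ι p) hpos
    ((g.inner (ι p) u).toLinearMap.comp (mfderiv I I' ι p).toLinearMap) w

theorem inner_normalPart_tangent
    (hpos : ∀ v : TangentSpace I p, v ≠ 0 → 0 < inducedMetric g ι p v v)
    (u : TangentSpace I' (ι p)) (w : TangentSpace I p) :
    g.inner (ι p) (normalPart I g ι p u) (mfderiv I I' ι p w) = 0 := by
  rw [normalPart, map_sub, sub_apply, inner_tangentialPart hpos, sub_self]

theorem inner_normalPart_normalPart
    (hpos : ∀ v : TangentSpace I p, v ≠ 0 → 0 < inducedMetric g ι p v v)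
    (u u' : TangentSpace I' (ι p)) :
    g.inner (ι p) (normalPart I g ι p u) (normalPart I g ι p u')
      = g.inner (ι p) u (normalPart I g ι p u') := by
  conv_lhs => rw [normalPart, map_sub, sub_apply, g.symm _ (mfderiv I I' ι p _),
    inner_normalPart_tangent hpos, sub_zero]

theorem inducedMetric_nondegenerate
    (hpos : ∀ v : TangentSpace I p, v ≠ 0 → 0 < inducedMetric g ι p v v)
    {v w : TangentSpace I p} (h : ∀ u, inducedMetric g ι p v u = inducedMetric g ι p w u) :
    v = w := by
  by_contra hne
  have h1 := hpos (v - w) (sub_ne_zero.2 hne)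
  have h2 := h (v - w)
  simp only [inducedMetric, map_sub, sub_apply] at h1 h2
  linarith

variable {J : Π x : M', TangentSpace I' x →L[ℝ] TangentSpace I' x}

theorem inner_opP (hpos : ∀ v : TangentSpace I p, v ≠ 0 → 0 < inducedMetric g ι p v v)
    (v w : TangentSpace I p) :
    g.inner (ι p) (J (ι p) (mfderiv I I' ι p v)) (mfderiv I I' ι p w)
      = g.inner (ι p) (mfderiv I I' ι p (opP g J ι p v)) (mfderiv I I' ι p w) :=
  (inner_tangentialPart hpos _ w).symm

theorem opF_eq (v : TangentSpace I p) :
    opF g J ι p v = J (ι p) (mfderiv I I' ι p v) - mfderiv I I' ι p (opP g J ι p v) := rfl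

variable {D Dθ : Π p : M, Submodule ℝ (TangentSpace I p)} {θ : M → ℝ}

theorem IsPointwiseSemiSlant.exists_eq (h : IsPointwiseSemiSlant g J ι D Dθ θ)
    {X : TangentSpace I p} (hX : X ∈ D p) :
    ∃ Y ∈ D p, J (ι p) (mfderiv I I' ι p X) = mfderiv I I' ι p Y := by
  have h1 : J (ι p) (mfderiv I I' ι p X) ∈ ((D p).map (mfderiv I I' ι p).toLinearMap).map
      (J (ι p)).toLinearMap := ⟨_, ⟨X, hX, rfl⟩, rfl⟩
  rw [h.invariant p] at h1
  obtain ⟨Y, hY, hY'⟩ := h1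
  exact ⟨Y, hY, hY'.symm⟩

theorem IsPointwiseSemiSlant.opP_mem_first (h : IsPointwiseSemiSlant g J ι D Dθ θ)
    (hpos : ∀ v : TangentSpace I p, v ≠ 0 → 0 < inducedMetric g ι p v v)
    {X : TangentSpace I p} (hX : X ∈ D p) :
    opP g J ι p X ∈ D p ∧ J (ι p) (mfderiv I I' ι p X) = mfderiv I I' ι p (opP g J ι p X) := by
  obtain ⟨Y, hY, hJY⟩ := h.exists_eq hX
  have : opP g J ι p X = Y := inducedMetric_nondegenerate hpos fun u => by
    rw [inducedMetric, inducedMetric, ← inner_opP hpos, hJY]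
  rw [this]
  exact ⟨hY, hJY⟩

theorem IsPointwiseSemiSlant.inner_J_eq_zero (h : IsPointwiseSemiSlant g J ι D Dθ θ)
    (hgJ : ∀ a b, g.inner (ι p) (J (ι p) a) b = - g.inner (ι p) a (J (ι p) b))
    {X Z : TangentSpace I p} (hX : X ∈ D p) (hZ : Z ∈ Dθ p) :
    g.inner (ι p) (mfderiv I I' ι p X) (J (ι p) (mfderiv I I' ι p Z)) = 0 := by
  obtain ⟨Y, hY, hJY⟩ := h.exists_eq hX
  have h1 := hgJ (mfderiv I I' ι p X) (mfderiv I I' ι p Z)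
  have h2 := h.orthogonal p Y hY Z hZ
  rw [inducedMetric] at h2
  rw [hJY, h2] at h1
  linarith

/-- `JZ` is orthogonal to `D`, so the `D`-component of `PZ` is orthogonal to itself. -/
theorem IsPointwiseSemiSlant.opP_mem_second (h : IsPointwiseSemiSlant g J ι D Dθ θ)
    (hpos : ∀ v : TangentSpace I p, v ≠ 0 → 0 < inducedMetric g ι p v v)
    (hgJ : ∀ a b, g.inner (ι p) (J (ι p) a) b = - g.inner (ι p) a (J (ι p) b))
    {Z : TangentSpace I p} (hZ : Z ∈ Dθ p) : opP g J ι p Z ∈ Dθ p := by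
  obtain ⟨a, ha, b, hb, hab⟩ := Submodule.mem_sup.1
    ((h.isCompl p).sup_eq_top ▸ Submodule.mem_top : opP g J ι p Z ∈ D p ⊔ Dθ p)
  have h1 : inducedMetric g ι p (opP g J ι p Z) a = 0 := by
    rw [inducedMetric, ← inner_opP hpos, g.symm, h.inner_J_eq_zero hgJ ha hZ]
  have h2 : inducedMetric g ι p a b = 0 := h.orthogonal p a ha b hb
  have h3 : a = 0 := by
    by_contra hne
    have h4 := hpos a hne
    rw [← hab] at h1
    simp only [inducedMetric, map_add, add_apply] at h1 h2 h4
    rw [g.symm _ (mfderiv I I' ι p b)] at h1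
    linarith
  rw [← hab, h3, zero_add]
  exact hb

/-- As `PZ` lies in `Dθ`, it is the projection of `JZ` to `Dθ`, so `θ = arccos (|PZ| / |JZ|)` with
`|JZ| = |Z|`. -/
theorem IsPointwiseSemiSlant.inducedMetric_opP_self (h : IsPointwiseSemiSlant g J ι D Dθ θ)
    (hpos : ∀ v : TangentSpace I p, v ≠ 0 → 0 < inducedMetric g ι p v v)
    (hherm : ∀ a b, g.inner (ι p) (J (ι p) a) (J (ι p) b) = g.inner (ι p) a b)
    (hgJ : ∀ a b, g.inner (ι p) (J (ι p) a) b = - g.inner (ι p) a (J (ι p) b))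
    {Z : TangentSpace I p} (hZ : Z ∈ Dθ p) :
    inducedMetric g ι p (opP g J ι p Z) (opP g J ι p Z)
      = Real.cos (θ p) ^ 2 * inducedMetric g ι p Z Z := by
  by_cases hZ0 : Z = 0
  · have h0 : ∀ u, inducedMetric g ι p (opP g J ι p Z) u = 0 := fun u => by
      rw [inducedMetric, ← inner_opP hpos, hZ0]
      simp
    rw [h0, hZ0]
    simp [inducedMetric]
  have hproj : projPart (fun v w => g.inner (ι p) v w)
      (fun W : Dθ p => mfderiv I I' ι p (W : TangentSpace I p)) (J (ι p) (mfderiv I I' ι p Z))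
      = (⟨opP g J ι p Z, h.opP_mem_second hpos hgJ hZ⟩ : Dθ p) := by
    refine (eq_sharp ((inducedBilin g ι p).domRestrict₁₂ (Dθ p) (Dθ p)) ?_
      ((g.inner (ι p) (J (ι p) (mfderiv I I' ι p Z))).toLinearMap.comp
        ((mfderiv I I' ι p).toLinearMap.comp (Dθ p).subtype)) _ ?_).symm
    · intro v hv
      exact hpos _ (fun h0 => hv (Subtype.ext h0))
    · intro w
      exact (inner_opP hpos Z _).symm
  have hs := h.slant p Z hZ hZ0
  rw [angleToRange, hproj] at hs
  have hs' : Real.arccos (√(inducedMetric g ι p (opP g J ι p Z) (opP g J ι p Z))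
      / √(inducedMetric g ι p Z Z)) = θ p := by
    rw [← hs, hherm]
    rfl
  -- Pythagoras for `JZ = FZ + PZ`; it puts the ratio in the range where `cos` inverts `arccos`.
  have hle : inducedMetric g ι p (opP g J ι p Z) (opP g J ι p Z) ≤ inducedMetric g ι p Z Z := by
    have hF : 0 ≤ g.inner (ι p) (opF g J ι p Z) (opF g J ι p Z) := by
      by_cases h0 : opF g J ι p Z = 0
      · rw [h0, map_zero]
      · exact (g.pos _ _ h0).le
    have e1 := inner_normalPart_tangent hpos (J (ι p) (mfderiv I I' ι p Z)) (opP g J ι p Z)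
    have e2 : g.inner (ι p) (opF g J ι p Z) (mfderiv I I' ι p (opP g J ι p Z)) = 0 := e1
    rw [show inducedMetric g ι p Z Z = _ from (hherm _ _).symm]
    have e3 : J (ι p) (mfderiv I I' ι p Z) = opF g J ι p Z + mfderiv I I' ι p (opP g J ι p Z) := by
      rw [opF_eq, sub_add_cancel]
    rw [e3, map_add, map_add, add_apply, add_apply, g.symm _ (mfderiv I I' ι p _) (opF g J ι p Z),
      e2, inducedMetric]
    linarith
  have hZpos := hpos Z hZ0
  have hn : 0 ≤ inducedMetric g ι p (opP g J ι p Z) (opP g J ι p Z) := by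
    by_cases h0 : opP g J ι p Z = 0
    · rw [h0, inducedMetric, map_zero, map_zero]
    · exact (hpos _ h0).le
  rw [← hs', Real.cos_arccos, div_pow, Real.sq_sqrt hn, Real.sq_sqrt hZpos.le,
    div_mul_cancel₀ _ hZpos.ne']
  · exact le_trans (by norm_num) (div_nonneg (Real.sqrt_nonneg _) (Real.sqrt_nonneg _))
  · exact div_le_one_of_le₀ (Real.sqrt_le_sqrt hle) (Real.sqrt_nonneg _)

theorem opP_add (hpos : ∀ v : TangentSpace I p, v ≠ 0 → 0 < inducedMetric g ι p v v)
    (v w : TangentSpace I p) : opP g J ι p (v + w) = opP g J ι p v + opP g J ι p w :=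
  inducedMetric_nondegenerate hpos fun u => by
    simp only [inducedMetric, map_add, add_apply]
    rw [← inner_opP hpos, ← inner_opP hpos, ← inner_opP hpos, map_add, map_add, map_add, add_apply]

/-- Polarization: the slant angle is the same for `Z`, `W` and `Z + W`. -/
theorem IsPointwiseSemiSlant.inducedMetric_opP (h : IsPointwiseSemiSlant g J ι D Dθ θ)
    (hpos : ∀ v : TangentSpace I p, v ≠ 0 → 0 < inducedMetric g ι p v v)
    (hherm : ∀ a b, g.inner (ι p) (J (ι p) a) (J (ι p) b) = g.inner (ι p) a b)
    (hgJ : ∀ a b, g.inner (ι p) (J (ι p) a) b = - g.inner (ι p) a (J (ι p) b))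
    {Z W : TangentSpace I p} (hZ : Z ∈ Dθ p) (hW : W ∈ Dθ p) :
    inducedMetric g ι p (opP g J ι p Z) (opP g J ι p W)
      = Real.cos (θ p) ^ 2 * inducedMetric g ι p Z W := by
  have h1 := h.inducedMetric_opP_self hpos hherm hgJ hZ
  have h2 := h.inducedMetric_opP_self hpos hherm hgJ hW
  have h3 := h.inducedMetric_opP_self hpos hherm hgJ ((Dθ p).add_mem hZ hW)
  have h4 := inducedMetric_comm (g := g) (ι := ι) Z W
  have h5 := inducedMetric_comm (g := g) (ι := ι) (opP g J ι p Z) (opP g J ι p W)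
  rw [opP_add hpos] at h3
  simp only [inducedMetric, map_add, add_apply] at h1 h2 h3 h4 h5 ⊢
  linear_combination (h3 - h1 - h2 + h5 - Real.cos (θ p) ^ 2 * h4) / 2

/-- The shape operator in terms of the ambient derivative `D' v w = ∇_v (dι w)`. -/
theorem inducedMetric_shapeOperator
    (hpos : ∀ v : TangentSpace I p, v ≠ 0 → 0 < inducedMetric g ι p v v)
    {cov : (Π x : M', TangentSpace I' x) → (Π x : M', TangentSpace I' x →L[ℝ] TangentSpace I' x)}
    {C : TangentSpace I p → TangentSpace I p →L[ℝ] TangentSpace I' (ι p)}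
    (hC : ∀ v w, C v w = C w v)
    (hcov : ∀ v w, covAlong cov ι (fun q => mfderiv I I' ι q
      (FiberBundle.extend E (E := fun x : M => TangentSpace I x) w q)) p v = C w v)
    (v w Z : TangentSpace I p) :
    inducedMetric g ι p (shapeOperator g cov ι p (opF g J ι p Z) v) w
      = g.inner (ι p) (C v w) (opF g J ι p Z) := by
  have h1 : ∀ w, g.inner (ι p) (secondFundamentalForm g cov ι p v w) (opF g J ι p Z)
      = ((g.inner (ι p) (opF g J ι p Z)).toLinearMap.comp (C v).toLinearMap) w := by
    intro w
    rw [secondFundamentalForm, hcov, hC, opF, inner_normalPart_normalPart hpos, g.symm]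
    rfl
  have h2 := sharp_spec (inducedBilin g ι p) hpos
    ((g.inner (ι p) (opF g J ι p Z)).toLinearMap.comp (C v).toLinearMap) w
  rw [shapeOperator, funext h1, g.symm]
  exact h2

theorem inner_leeField [FiniteDimensional ℝ E'] (g : RMetric I' M')
    (α : Π x : M', TangentSpace I' x →L[ℝ] ℝ) (x : M') (u : TangentSpace I' x) :
    g.inner x (leeField g α x) u = α x u :=
  sharp_spec (LinearMap.mk₂ ℝ (fun v w => g.inner x v w) (by simp) (by simp) (by simp) (by simp))
    (g.pos x) (α x).toLinearMap u

end Submanifold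

/-! ### Comparing the connections of conformal metrics. -/

section Conformal

variable {E : Type*} [NormedAddCommGroup E] [NormedSpace ℝ E]
  {H : Type*} [TopologicalSpace H] {I : ModelWithCorners ℝ E H}
  {M : Type*} [TopologicalSpace M] [ChartedSpace H M] [IsManifold I ∞ M]

/-- The difference of the Levi-Civita connections of conformal metrics. -/
theorem inner_conformal_difference {g : RMetric I M}
    {cov cov' : (Π x : M, TangentSpace I x) → (Π x : M, TangentSpace I x →L[ℝ] TangentSpace I x)}
    {U U' : Set M} {φ : M → ℝ} (h : IsLeviCivitaOn g.inner cov U)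
    (h' : IsLeviCivitaOn (fun y => Real.exp (-φ y) • g.inner y) cov' U') {x : M} (hx : x ∈ U)
    (hx' : x ∈ U') (hφ : MDifferentiableAt I 𝓘(ℝ, ℝ) φ x) (a b c : TangentSpace I x) :
    g.inner x (cov' (FiberBundle.extend E b) x a - cov (FiberBundle.extend E b) x a) c
      = -(mvfderiv I φ x a * g.inner x b c + mvfderiv I φ x b * g.inner x a c
        - mvfderiv I φ x c * g.inner x a b) / 2 := by
  -- Subtracting the two compatibility identities. With the symmetry `e` of the difference, the
  -- Koszul combination of three instances determines it.
  have key : ∀ a b c : TangentSpace I x,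
      mvfderiv I φ x a * g.inner x b c
        + g.inner x (cov' (FiberBundle.extend E b) x a - cov (FiberBundle.extend E b) x a) c
        + g.inner x (cov' (FiberBundle.extend E c) x a - cov (FiberBundle.extend E c) x a) b
        = 0 := by
    intro a b c
    have h1 := h.metric x hx _ _ (diffField_extend b) (diffField_extend c) a
    have h2 := h'.mvfderiv_conformal hx' hφ (diffField_extend b) (diffField_extend c) a
    rw [h1] at h2
    simp only [FiberBundle.extend_apply_self] at h2
    rw [g.symm x b (cov _ x a), g.symm x b (cov' _ x a)] at h2
    simp only [map_sub, sub_apply]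
    linarith
  have e : ∀ a b : TangentSpace I x,
      cov' (FiberBundle.extend E b) x a - cov (FiberBundle.extend E b) x a
        = cov' (FiberBundle.extend E a) x b - cov (FiberBundle.extend E a) x b := by
    intro a b
    rw [h.extend_comm hx, h'.extend_comm hx']
  have k1 := key a b c
  have k2 := key b a c
  have k3 := key c a b
  rw [e c b, e c a] at k3
  rw [e b a] at k2
  linarith

end Conformal

/-! ### The ambient derivative along the immersion. -/

section Derivative

variable {E : Type*} [NormedAddCommGroup E] [NormedSpace ℝ E]
  {H : Type*} [TopologicalSpace H] {I : ModelWithCorners ℝ E H} [I.Boundaryless]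
  {M : Type*} [TopologicalSpace M] [ChartedSpace H M] [IsManifold I ∞ M]
  {E' : Type*} [NormedAddCommGroup E'] [NormedSpace ℝ E'] [FiniteDimensional ℝ E']
  {H' : Type*} [TopologicalSpace H'] {I' : ModelWithCorners ℝ E' H'}
  {M' : Type*} [TopologicalSpace M'] [ChartedSpace H' M'] [IsManifold I' ∞ M']

/-- The map `v ↦ ∇_v (dι w)`, where `w` is extended by the field which is constant in the
preferred chart at `p`. -/
noncomputable def ambientDeriv
    (cov : (Π x : M', TangentSpace I' x) → (Π x : M', TangentSpace I' x →L[ℝ] TangentSpace I' x))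
    (ι : M → M') (p : M) (w : TangentSpace I p) : TangentSpace I p →L[ℝ] TangentSpace I' (ι p) :=
  (show TangentSpace I p →L[ℝ] TangentSpace I' (ι p) from
    (fderiv ℝ (fderiv ℝ (writtenInExtChartAt I I' p ι)) (extChartAt I p p)).flip w)
  + (cov (FiberBundle.extend E' (mfderiv I I' ι p w)) (ι p)).comp (mfderiv I I' ι p)

theorem ambientDeriv_apply
    (cov : (Π x : M', TangentSpace I' x) → (Π x : M', TangentSpace I' x →L[ℝ] TangentSpace I' x))
    (ι : M → M') (p : M) (v w : TangentSpace I p) :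
    ambientDeriv cov ι p w v = coordHess I I' ι p v w
      + cov (FiberBundle.extend E' (mfderiv I I' ι p w)) (ι p) (mfderiv I I' ι p v) := rfl

variable {cov cov' : (Π x : M', TangentSpace I' x) →
    (Π x : M', TangentSpace I' x →L[ℝ] TangentSpace I' x)}
  {ι : M → M'} {p : M} {g : RMetric I' M'} {U : Set M'}

/-- Second derivatives commute and the connection has no torsion. The metric `b` is arbitrary, so
the local Kähler connection is covered as well. -/
theorem ambientDeriv_comm (hι : ContMDiff I I' ∞ ι)
    {b : Π x : M', TangentSpace I' x →L[ℝ] TangentSpace I' x →L[ℝ] ℝ}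
    (h : IsLeviCivitaOn b cov U) (hp : ι p ∈ U) (v w : TangentSpace I p) :
    ambientDeriv cov ι p v w = ambientDeriv cov ι p w v := by
  rw [ambientDeriv_apply, ambientDeriv_apply, coordHess_comm hι, h.extend_comm hp]

theorem mvfderiv_inducedMetric_extend (hι : ContMDiff I I' ∞ ι)
    (h : IsLeviCivitaOn g.inner cov U) (hp : ι p ∈ U) (v Y Z : TangentSpace I p) :
    mvfderiv I (fun q => inducedMetric g ι q (FiberBundle.extend E Y q)
        (FiberBundle.extend E Z q)) p v
      = g.inner (ι p) (ambientDeriv cov ι p Y v) (mfderiv I I' ι p Z)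
        + g.inner (ι p) (mfderiv I I' ι p Y) (ambientDeriv cov ι p Z v) := by
  have h1 := mvfderiv_pullback_bilin hι g.inner (p := p)
    (fun a c => RMetric.mdifferentiableAt_apply g (diffField_extend a) (diffField_extend c)) v Y Z
  refine h1.trans ?_
  rw [h.metric (ι p) hp _ _ (diffField_extend _) (diffField_extend _)]
  simp only [FiberBundle.extend_apply_self, ambientDeriv_apply, map_add, add_apply]
  ring

theorem mvfderiv_fundForm_pullback {J : Π x : M', TangentSpace I' x →L[ℝ] TangentSpace I' x}
    (hι : ContMDiff I I' ∞ ι) (hJ : IsComplexStructure J) {φ : M' → ℝ}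
    (h : IsLeviCivitaOn (fun y => Real.exp (-φ y) • g.inner y) cov U)
    (hpar : IsParallelOn cov J U) (hp : ι p ∈ U) (hφ : MDifferentiableAt I' 𝓘(ℝ, ℝ) φ (ι p))
    (v Y Z : TangentSpace I p) :
    mvfderiv I (fun q => g.inner (ι q) (mfderiv I I' ι q (FiberBundle.extend E Y q))
        (J (ι q) (mfderiv I I' ι q (FiberBundle.extend E Z q)))) p v
      = mvfderiv I' φ (ι p) (mfderiv I I' ι p v)
          * g.inner (ι p) (mfderiv I I' ι p Y) (J (ι p) (mfderiv I I' ι p Z))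
        + g.inner (ι p) (ambientDeriv cov ι p Y v) (J (ι p) (mfderiv I I' ι p Z))
        + g.inner (ι p) (mfderiv I I' ι p Y) (J (ι p) (ambientDeriv cov ι p Z v)) := by
  have h1 := mvfderiv_pullback_bilin hι (fundFormL g J) (p := p)
    (fun a c => RMetric.mdifferentiableAt_apply g (diffField_extend a)
      (hJ.diffField (diffField_extend c))) v Y Z
  refine h1.trans ?_
  simp only [fundFormL_apply]
  rw [mvfderiv_fundForm_extend hJ h hpar hp hφ]
  simp only [ambientDeriv_apply, map_add, add_apply]
  ring

end Derivative

end SemiSlantWarped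

/-! ### The two identities. -/

open scoped Topology

theorem theorem4p2
    -- the ambient manifold
    {E : Type*} [NormedAddCommGroup E] [NormedSpace ℝ E] [FiniteDimensional ℝ E]
    {M : Type*} [TopologicalSpace M] [T2Space M] [SecondCountableTopology M]
    [ChartedSpace E M] [IsManifold 𝓘(ℝ, E) ∞ M]
    -- the two factors
    {E₁ : Type*} [NormedAddCommGroup E₁] [NormedSpace ℝ E₁] [FiniteDimensional ℝ E₁]
    {NT : Type*} [TopologicalSpace NT] [T2Space NT] [SecondCountableTopology NT]
    [ChartedSpace E₁ NT] [IsManifold 𝓘(ℝ, E₁) ∞ NT]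
    {E₂ : Type*} [NormedAddCommGroup E₂] [NormedSpace ℝ E₂] [FiniteDimensional ℝ E₂]
    {Nθ : Type*} [TopologicalSpace Nθ] [T2Space Nθ] [SecondCountableTopology Nθ]
    [ChartedSpace E₂ Nθ] [IsManifold 𝓘(ℝ, E₂) ∞ Nθ]
    -- the LCK structure, its Lee form and its Levi-Civita connection
    (g : RMetric 𝓘(ℝ, E) M) (J : Π x : M, TangentSpace 𝓘(ℝ, E) x →L[ℝ] TangentSpace 𝓘(ℝ, E) x)
    (hLCK : IsLCK g J)
    (α : Π x : M, TangentSpace 𝓘(ℝ, E) x →L[ℝ] ℝ) (hα : IsLeeForm g J α)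
    (nabla : CovariantDerivative 𝓘(ℝ, E) E (fun x : M => TangentSpace 𝓘(ℝ, E) x))
    (hnabla : IsLeviCivitaOn g.inner nabla Set.univ)
    -- the warped product, isometrically immersed
    (gT : RMetric 𝓘(ℝ, E₁) NT) (gθ : RMetric 𝓘(ℝ, E₂) Nθ)
    (f : NT → ℝ) (hf : ContMDiff 𝓘(ℝ, E₁) 𝓘(ℝ, ℝ) ∞ f) (hfpos : ∀ a, 0 < f a)
    (ι : NT × Nθ → M) (hι : ContMDiff (𝓘(ℝ, E₁).prod 𝓘(ℝ, E₂)) 𝓘(ℝ, E) ∞ ι)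
    (hiso : ∀ (p : NT × Nθ) (X Y : TangentSpace (𝓘(ℝ, E₁).prod 𝓘(ℝ, E₂)) p),
      inducedMetric g ι p X Y = warpedMetric gT gθ f p X Y)
    -- it is a proper pointwise semi-slant submanifold
    (θ : NT × Nθ → ℝ)
    (hsemi : IsPointwiseSemiSlant g J ι (firstFactor 𝓘(ℝ, E₁) 𝓘(ℝ, E₂))
      (secondFactor 𝓘(ℝ, E₁) 𝓘(ℝ, E₂)) θ)
    (hdim : Module.finrank ℝ E₁ ≠ 0) (hproper : ∀ p, 0 < Real.cos (θ p) ^ 2)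
    -- the Lee vector field is tangent to it
    (hLee : ∀ p : NT × Nθ, leeField g α (ι p) ∈
      Set.range (mfderiv (𝓘(ℝ, E₁).prod 𝓘(ℝ, E₂)) 𝓘(ℝ, E) ι p)) :
    -- first identity
    (∀ p : NT × Nθ, ∀ X ∈ firstFactor 𝓘(ℝ, E₁) 𝓘(ℝ, E₂) p,
      ∀ Y ∈ firstFactor 𝓘(ℝ, E₁) 𝓘(ℝ, E₂) p, ∀ Z ∈ secondFactor 𝓘(ℝ, E₁) 𝓘(ℝ, E₂) p,
      inducedMetric g ι p (shapeOperator g nabla ι p (opF g J ι p Z) X) Y = 0) ∧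
    -- second identity; on the first factor `J X` is tangent, that is `J X = P X`
    (∀ p : NT × Nθ, ∀ X ∈ firstFactor 𝓘(ℝ, E₁) 𝓘(ℝ, E₂) p,
      ∀ Z ∈ secondFactor 𝓘(ℝ, E₁) 𝓘(ℝ, E₂) p, ∀ W ∈ secondFactor 𝓘(ℝ, E₁) 𝓘(ℝ, E₂) p,
      inducedMetric g ι p
          (shapeOperator g nabla ι p (opF g J ι p Z) (opP g J ι p X)
            - shapeOperator g nabla ι p (opF g J ι p (opP g J ι p Z)) X) W
        = Real.sin (θ p) ^ 2
          * (mvfderiv (𝓘(ℝ, E₁).prod 𝓘(ℝ, E₂)) (fun q : NT × Nθ => Real.log (f q.1)) p X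
            - α (ι p) (mfderiv (𝓘(ℝ, E₁).prod 𝓘(ℝ, E₂)) 𝓘(ℝ, E) ι p X))
          * inducedMetric g ι p Z W) := by
  have hpos : ∀ (p : NT × Nθ) (v : TangentSpace (𝓘(ℝ, E₁).prod 𝓘(ℝ, E₂)) p), v ≠ 0 →
      0 < inducedMetric g ι p v v := fun p v hv => by
    rw [hiso]
    exact warpedMetric_pos gT gθ hfpos p hv
  have hgJ := hLCK.inner_J_left
  have hC : ∀ (p : NT × Nθ) (v w : TangentSpace (𝓘(ℝ, E₁).prod 𝓘(ℝ, E₂)) p),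
      ambientDeriv nabla ι p v w = ambientDeriv nabla ι p w v := fun p =>
    ambientDeriv_comm hι hnabla (mem_univ _)
  have hcov := fun (p : NT × Nθ) v w => (covAlong_extend hι nabla (p := p) v w).trans
    (ambientDeriv_apply nabla ι p v w).symm
  have hperp := hsemi.orthogonal
  have hΩ := fun (p : NT × Nθ) X hX Z hZ => hsemi.inner_J_eq_zero (p := p) (hgJ _) (X := X) (Z := Z)
    hX hZ
  have hPA := fun (p : NT × Nθ) X hX => hsemi.opP_mem_first (hpos p) (X := X) hX
  have hPB := fun (p : NT × Nθ) Z hZ => hsemi.opP_mem_second (hpos p) (hgJ _) (Z := Z) hZ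
  have hA : ∀ p : NT × Nθ, ∃ X ∈ firstFactor 𝓘(ℝ, E₁) 𝓘(ℝ, E₂) p, X ≠ 0 := by
    have : Nontrivial E₁ := Module.nontrivial_of_finrank_pos (R := ℝ) (Nat.pos_of_ne_zero hdim)
    exact firstFactor_ne_bot
  have hK := fun (p : NT × Nθ) => mvfderiv_inducedMetric_extend (g := g) hι hnabla (mem_univ (ι p))
  have hmix : ∀ (p : NT × Nθ) v, ∀ X ∈ firstFactor 𝓘(ℝ, E₁) 𝓘(ℝ, E₂) p,
      ∀ Z ∈ secondFactor 𝓘(ℝ, E₁) 𝓘(ℝ, E₂) p, mvfderiv (𝓘(ℝ, E₁).prod 𝓘(ℝ, E₂))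
        (fun q => inducedMetric g ι q (FiberBundle.extend (E₁ × E₂) X q)
          (FiberBundle.extend (E₁ × E₂) Z q)) p v = 0 := by
    intro p v X hX Z hZ
    simp only [hiso]
    exact mvfderiv_warpedMetric_mixed gT gθ f hX hZ v
  have hfirst : ∀ p : NT × Nθ, ∀ v ∈ secondFactor 𝓘(ℝ, E₁) 𝓘(ℝ, E₂) p,
      ∀ X ∈ firstFactor 𝓘(ℝ, E₁) 𝓘(ℝ, E₂) p, ∀ Y ∈ firstFactor 𝓘(ℝ, E₁) 𝓘(ℝ, E₂) p,
      mvfderiv (𝓘(ℝ, E₁).prod 𝓘(ℝ, E₂))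
        (fun q => inducedMetric g ι q (FiberBundle.extend (E₁ × E₂) X q)
          (FiberBundle.extend (E₁ × E₂) Y q)) p v = 0 := by
    intro p v hv X hX Y hY
    simp only [hiso]
    exact mvfderiv_warpedMetric_first gT gθ f hX hv
  have hsecond : ∀ p : NT × Nθ, ∀ v ∈ firstFactor 𝓘(ℝ, E₁) 𝓘(ℝ, E₂) p,
      ∀ Z ∈ secondFactor 𝓘(ℝ, E₁) 𝓘(ℝ, E₂) p, ∀ W ∈ secondFactor 𝓘(ℝ, E₁) 𝓘(ℝ, E₂) p,
      mvfderiv (𝓘(ℝ, E₁).prod 𝓘(ℝ, E₂))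
        (fun q => inducedMetric g ι q (FiberBundle.extend (E₁ × E₂) Z q)
          (FiberBundle.extend (E₁ × E₂) W q)) p v
      = 2 * mvfderiv (𝓘(ℝ, E₁).prod 𝓘(ℝ, E₂)) (fun q : NT × Nθ => Real.log (f q.1)) p v
        * inducedMetric g ι p Z W := by
    intro p v hv Z hZ W hW
    simp only [hiso]
    exact mvfderiv_warpedMetric_second gT gθ hf hfpos hZ hv
  have k1 := fun (p : NT × Nθ) X hX Y hY Z hZ => koszul_first (g.symm (ι p)) (hC p) (hK p) (hmix p)
    (hfirst p) (X := X) (Y := Y) (Z := Z) hX hY hZ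
  have k2 := fun (p : NT × Nθ) X hX Z hZ W hW => koszul_second (g.symm (ι p)) (hC p) (hK p)
    (hmix p) (hsecond p) (X := X) (Z := Z) (W := W) hX hZ hW
  have k3 := fun (p : NT × Nθ) X hX Z hZ W hW => koszul_second' (g.symm (ι p)) (hC p) (hK p)
    (hmix p) (hsecond p) (X := X) (Z := Z) (W := W) hX hZ hW
  have k1' : ∀ p : NT × Nθ, ∀ X ∈ firstFactor 𝓘(ℝ, E₁) 𝓘(ℝ, E₂) p,
      ∀ Y ∈ firstFactor 𝓘(ℝ, E₁) 𝓘(ℝ, E₂) p, ∀ Z ∈ secondFactor 𝓘(ℝ, E₁) 𝓘(ℝ, E₂) p,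
      g.inner (ι p) (mfderiv (𝓘(ℝ, E₁).prod 𝓘(ℝ, E₂)) 𝓘(ℝ, E) ι p Y)
        (ambientDeriv nabla ι p Z X) = 0 := by
    intro p X hX Y hY Z hZ
    have h1 := hmix p X Y hY Z hZ
    rw [hK, k1 p Y hY X hX Z hZ, zero_add] at h1
    exact h1
  have hLinj : ∀ (p : NT × Nθ) (v : TangentSpace (𝓘(ℝ, E₁).prod 𝓘(ℝ, E₂)) p),
      mfderiv (𝓘(ℝ, E₁).prod 𝓘(ℝ, E₂)) 𝓘(ℝ, E) ι p v = 0 → v = 0 := by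
    intro p v hv
    by_contra hne
    have := hpos p v hne
    rw [inducedMetric, hv, map_zero] at this
    exact lt_irrefl _ this
  have kJ : ∀ (p : NT × Nθ) (v : TangentSpace (𝓘(ℝ, E₁).prod 𝓘(ℝ, E₂)) p),
      ∀ Y ∈ firstFactor 𝓘(ℝ, E₁) 𝓘(ℝ, E₂) p, ∀ Z ∈ secondFactor 𝓘(ℝ, E₁) 𝓘(ℝ, E₂) p,
      letI L := mfderiv (𝓘(ℝ, E₁).prod 𝓘(ℝ, E₂)) 𝓘(ℝ, E) ι p
      g.inner (ι p) (ambientDeriv nabla ι p Y v) (J (ι p) (L Z))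
        = α (ι p) (L Y) * g.inner (ι p) (L v) (J (ι p) (L Z))
          - α (ι p) (J (ι p) (L Z)) * g.inner (ι p) (L v) (L Y)
          + g.inner (ι p) (J (ι p) (L Y)) (ambientDeriv nabla ι p Z v)
          - α (ι p) (L Z) * g.inner (ι p) (L v) (J (ι p) (L Y))
          + α (ι p) (J (ι p) (L Y)) * g.inner (ι p) (L v) (L Z) := by
    intro p v Y hY Z hZ
    obtain ⟨U, hU, hpU, φ, hφ, cov, hcovU, hpar⟩ := hLCK.locally_conformal (ι p)
    have hφp : MDifferentiableAt 𝓘(ℝ, E) 𝓘(ℝ, ℝ) φ (ι p) :=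
      (hφ.contMDiffAt (hU.mem_nhds hpU)).mdifferentiableAt (by simp)
    refine inner_J_of_lck (g := g.inner (ι p)) (J := J (ι p)) (α := α (ι p))
      (δ := mvfderiv 𝓘(ℝ, E) φ (ι p))
      -- The Hessians cancel in `S`, leaving the difference of the Kähler and the given connection.
      (S := fun v w => ambientDeriv cov ι p w v - ambientDeriv nabla ι p w v)
      (g.symm (ι p)) (hC p) (hLinj p)
      (hLCK.complex.sq (ι p)) (hgJ (ι p)) (hperp p) (hΩ p) (hA p) ?_ ?_ ?_ v hY hZ
    · intro v w c
      rw [← inner_conformal_difference hnabla hcovU (mem_univ _) hpU hφp, ambientDeriv_apply,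
        ambientDeriv_apply, add_sub_add_left_eq_sub]
    · intro v Y hY Z hZ
      have h1 := mvfderiv_fundForm_pullback (g := g) hι hLCK.complex hcovU hpar hpU hφp v Y Z
      -- `g(Y, JZ)` vanishes in a neighbourhood of `p`, not only at `p`, since the extensions remain
      -- in the two distributions.
      have h2 : (fun q => g.inner (ι q) (mfderiv (𝓘(ℝ, E₁).prod 𝓘(ℝ, E₂)) 𝓘(ℝ, E) ι q
          (FiberBundle.extend (E₁ × E₂) Y q)) (J (ι q) (mfderiv (𝓘(ℝ, E₁).prod 𝓘(ℝ, E₂)) 𝓘(ℝ, E)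
            ι q (FiberBundle.extend (E₁ × E₂) Z q)))) =ᶠ[𝓝 p] fun _ => (0 : ℝ) := by
        filter_upwards [extend_mem_firstFactor hY, extend_mem_secondFactor hZ] with q hq1 hq2
        exact hΩ q _ hq1 _ hq2
      rw [mvfderiv_congr_of_eventuallyEq h2, mvfderiv_const, hΩ p Y hY Z hZ, zero_apply] at h1
      rw [add_sub_cancel, add_sub_cancel, hgJ]
      linarith
    · intro a b hb hab hJab
      exact hα.two_mul_eq hLCK hcovU hpar hpU hφp hb hab hJab
  have hℓ : ∀ p : NT × Nθ, ∃ ℓ : TangentSpace (𝓘(ℝ, E₁).prod 𝓘(ℝ, E₂)) p, ∀ u,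
      α (ι p) u = g.inner (ι p) (mfderiv (𝓘(ℝ, E₁).prod 𝓘(ℝ, E₂)) 𝓘(ℝ, E) ι p ℓ) u := by
    intro p
    obtain ⟨ℓ, hℓ⟩ := hLee p
    refine ⟨ℓ, fun u => ?_⟩
    rw [hℓ]
    exact (inner_leeField g α (ι p) u).symm
  have hαB := fun (p : NT × Nθ) Z hZ => lee_eq_zero_on_second (g.symm (ι p)) (hC p) (hpos p)
    (hLCK.complex.sq (ι p)) (hgJ (ι p)) (hperp p) (hΩ p) (hA p) (fun X hX => (hPA p X hX).1)
    (fun X hX => (hPA p X hX).2) (k1' p) (kJ p) (Z := Z) hZ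
  constructor
  · intro p X hX Y hY Z hZ
    obtain ⟨ℓ, hℓ⟩ := hℓ p
    rw [inducedMetric_shapeOperator (hpos p) (hC p) (hcov p), opF_eq]
    exact inner_normal_eq_zero (g.symm (ι p)) (hperp p) (hΩ p) (fun X hX => (hPA p X hX).1)
      (fun X hX => (hPA p X hX).2) (hPB p) (inner_opP (hpos p)) hℓ (k1 p) (k1' p) (kJ p) (hαB p)
      hY hX hZ
  · intro p X hX Z hZ W hW
    obtain ⟨ℓ, hℓ⟩ := hℓ p
    have h1 := inner_normal_mixed_sub (g.symm (ι p)) (hpos p) (hLCK.complex.sq (ι p)) (hgJ (ι p))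
      (fun X hX => (hPA p X hX).1) (fun X hX => (hPA p X hX).2) (hPB p) (inner_opP (hpos p))
      (fun Z hZ W hW => hsemi.inducedMetric_opP (hpos p) (hLCK.hermitian (ι p)) (hgJ (ι p)) hZ hW)
      (fun X hX Z hZ W hW => inner_normal_mixed (g.symm (ι p)) (fun X hX => (hPA p X hX).1)
        (fun X hX => (hPA p X hX).2) (hPB p) (inner_opP (hpos p)) hℓ (k2 p) (k3 p) (kJ p) (hαB p)
        hX hZ hW) hX hZ hW
    have h2 : ∀ a b : TangentSpace (𝓘(ℝ, E₁).prod 𝓘(ℝ, E₂)) p, inducedMetric g ι p (a - b) W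
        = inducedMetric g ι p a W - inducedMetric g ι p b W := fun a b => by
      simp only [inducedMetric, map_sub, sub_apply]
    rw [h2, inducedMetric_shapeOperator (hpos p) (hC p) (hcov p),
      inducedMetric_shapeOperator (hpos p) (hC p) (hcov p), opF_eq, opF_eq, Real.sin_sq]
    exact h1
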